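/- **Setting.** Let $\Theta\subseteq\mathbb R$ be a nonempty open interval, $b:\Theta\to\mathbb R$ strictly convex and twice differentiable, and $m$ a measure on $\mathbb R$ such that for every $\eta\in\Theta$ the function $x\mapsto e^{x\eta-b(\eta)}$ is a probability density with respect to $m$. For a mean $\mu\in\mathcal I:=\dot b(\Theta)$ put $\eta_\mu:=\dot b^{-1}(\mu)$ and let $\nu^\mu$ be the distribution with density $e^{x\eta_\mu-b(\eta_\mu)}$. For $y\in\mathcal I$ let $d(x,y):=\mathrm{KL}(\nu^x,\nu^y)$ if $x\in\mathcal I$, and, for real $x\notin\mathcal I$, $d(x,y):=\sup_{\eta\in\Theta}\big[(\eta-\eta_y)x-(b(\eta)-b(\eta_y))\big]\in[0,\infty]$ (the maximal log-likelihood ratio per observation; it continues the KL divergence to the end points of $\mathcal I$). Let $d^+(x,y):=d(x,y)\mathbf 1_{(x\le y)}$. Consider $K$ arms with means $\mu_1,\dots,\mu_K\in\mathcal I$. At each round $s\ge 1$ an arm $A_s\in[K]=\{1,\dots,K\}$ is selected by an arbitrary, possibly randomized, sampling rule, and a sample $X_s$ is observed whose conditional law given $A_1,X_1,\dots,A_{s-1},X_{s-1},A_s$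 is $\nu^{\mu_{A_s}}$. Write $N_a(t)=\sum_{s=1}^t\mathbf 1_{(A_s=a)}$ and $\hat\mu_a(t)=\frac1{N_a(t)}\sum_{s=1}^tX_s\mathbf 1_{(A_s=a)}$. Let $h(u)=u-\ln u$ for $u\ge1$, with inverse $h^{-1}:[1,\infty)\to[1,\infty)$; for $z\in(1,e]$ let $$\tilde h_z(x)=\begin{cases}e^{1/h^{-1}(x)}\,h^{-1}(x)&\text{if }x\ge h(1/\ln z),\\ z\,(x-\ln\ln z)&\text{otherwise,}\end{cases}\qquad \mathcal T(x)=2\,\tilde h_{3/2}\!\left(\frac{h^{-1}(1+x)+\ln(2\zeta(2))}{2}\right)\quad(x\ge0).$$ Let $\delta\in(0,1)$ and let $\tilde\pi$ be a probability distribution over the subsets of $[K]$. With $$E_a(t,\theta):=\big[N_a(t)\,d^+(\hat\mu_a(t),\theta)-3\ln(1+\ln N_a(t))\big]^+$$ ($:=0$ if $N_a(t)=0$), define for $\theta\in\mathcal I$ $$\Phi_t(\theta):=\max_{\emptyset\ne S\subseteq[K],\ \tilde\pi(S)>0}\left[\sum_{a\in S}E_a(t,\theta)-|S|\,\mathcal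 T\!\left(\frac{\ln\frac1{\delta\tilde\pi(S)}}{|S|}\right)\right]$$ (a maximum over no sets is $-\infty$), and define the confidence region $$\mathcal C_t:=\left\{\lambda\in\mathcal I^K:\ \sum_{a\in S}E_a(t,\lambda_a)\le|S|\,\mathcal T\!\left(\frac{\ln\frac1{\delta\tilde\pi(S)}}{|S|}\right)\text{ for all nonempty }S\subseteq[K]\text{ with }\tilde\pi(S)>0\right\}.$$ **Proposition 7.1.** 1. With probability at least $1-\delta$, the following holds for all $t\in\mathbb N$: if $\theta(t)\in\mathcal I$ solves $\Phi_t(\theta)=0$, then $\min_a\mu_a\le\theta(t)$. 2. For every $t$ and every realization, a solution $\theta(t)\in\mathcal I$ of $\Phi_t(\theta)=0$ equals the projected upper confidence bound $\max\{\min_a\lambda_a:\lambda\in\mathcal C_t\}$, and this maximum is attained; in particular the solution is unique when it exists. 3. For every $t$ and every realization, a solution exists as soon as $0\le\Phi_t(\theta_1)<\infty$ for some $\theta_1\in\mathcal I$. -/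

import Mathlib

open MeasureTheory
open scoped ENNReal

/-! ### One-parameter canonical exponential families -/

/-- A one-parameter canonical exponential family: natural parameters in an open interval `Θ`,
a strictly convex, twice differentiable log-partition function `b` on `Θ`, and a reference
measure `m`, such that `x ↦ exp (x θ - b θ)` is a probability density with respect to `m` for
every `θ ∈ Θ`. -/
structure ExpFamily where
  Θ : Set ℝ
  b : ℝ → ℝ
  m : Measure ℝ
  isOpen_Θ : IsOpen Θ
  nonempty_Θ : Θ.Nonempty
  strictConvexOn_b : StrictConvexOn ℝ Θ b
  differentiableOn_b : DifferentiableOn ℝ b Θ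
  differentiableOn_deriv_b : DifferentiableOn ℝ (deriv b) Θ
  lintegral_density : ∀ θ ∈ Θ, ∫⁻ x, ENNReal.ofReal (Real.exp (x * θ - b θ)) ∂m = 1

namespace ExpFamily

/-- The set `ḃ(Θ)` of possible means. -/
def means (F : ExpFamily) : Set ℝ := deriv F.b '' F.Θ

/-- The natural parameter `ḃ⁻¹(μ) ∈ Θ` of a mean `μ ∈ ḃ(Θ)`. -/
noncomputable def natParam (F : ExpFamily) (μ : ℝ) : ℝ := Function.invFunOn (deriv F.b) F.Θ μ

/-- The member `ν^μ` of the family with mean `μ`. -/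
noncomputable def dist (F : ExpFamily) (μ : ℝ) : Measure ℝ :=
  F.m.withDensity fun x => ENNReal.ofReal (Real.exp (x * F.natParam μ - F.b (F.natParam μ)))

open Classical in
/-- The divergence `d(x, y)`, for `y` a possible mean. If `x` is a possible mean, it is the
Kullback-Leibler divergence from `ν^x` to `ν^y`. Empirical means may fall outside `ḃ(Θ)` (such as
`0` and `1` for Bernoulli distributions); there `d(x, y)` is the maximal log-likelihood ratio, per
observation, against `ν^y` for observations of average `x`. It extends the Kullback-Leibler
divergence continuously to the end points of `ḃ(Θ)`. -/
noncomputable def div (F : ExpFamily) (x y : ℝ) : ℝ≥0∞ :=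
  if x ∈ F.means then InformationTheory.klDiv (F.dist x) (F.dist y)
  else ⨆ l ∈ F.Θ, ENNReal.ofReal ((l - F.natParam y) * x - (F.b l - F.b (F.natParam y)))

open Classical in
/-- The one-sided divergence `d⁺(x, y) = d(x, y) 1_{x ≤ y}`. -/
noncomputable def divPlus (F : ExpFamily) (x y : ℝ) : ℝ≥0∞ := if x ≤ y then F.div x y else 0

end ExpFamily

/-! ### The threshold function -/

/-- `h(u) = u - ln u`, of interest for `u ≥ 1`. -/
noncomputable def hFun (u : ℝ) : ℝ := u - Real.log u

/-- The inverse of `h : [1, ∞) → [1, ∞)`. -/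
noncomputable def hInv (x : ℝ) : ℝ := Function.invFunOn hFun (Set.Ici 1) x

open Classical in
/-- The function `h̃_z`, that is `h̃_z(x) = min_{1 < y ≤ z} y (x - ln ln y)`, in closed form. -/
noncomputable def hTilde (z x : ℝ) : ℝ :=
  if hFun (1 / Real.log z) ≤ x then Real.exp (1 / hInv x) * hInv x
  else z * (x - Real.log (Real.log z))

/-- `ζ(2)`. -/
noncomputable def zetaTwo : ℝ := ∑' n : ℕ, 1 / ((n : ℝ) + 1) ^ 2

/-- The threshold function `𝒯`. -/
noncomputable def threshold (x : ℝ) : ℝ :=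
  2 * hTilde (3 / 2) ((hInv (1 + x) + Real.log (2 * zetaTwo)) / 2)

/-! ### Bandit models -/

section Bandit

variable {K : ℕ} {Ω : Type*}

/-- The observations `(A₁, X₁, …, A_s, X_s)` of the first `s` rounds (`A i`, `X i` belong to
round `i + 1`). -/
def history (A : ℕ → Ω → Fin K) (X : ℕ → Ω → ℝ) (s : ℕ) (ω : Ω) : Fin s → Fin K × ℝ :=
  fun i => (A i ω, X i ω)

/-- `A` and `X` are the arms and samples of a bandit model with vector of means `μ`, under an
arbitrary sampling rule: given the past observations and the arm selected now, the new sample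
has law `ν^{μ_a}`, where `a` is the selected arm. How the arm is selected, from the past and
possibly from additional randomness, is unrestricted. -/
structure IsBandit [MeasurableSpace Ω] (F : ExpFamily) (μ : Fin K → ℝ) (P : Measure Ω)
    (A : ℕ → Ω → Fin K) (X : ℕ → Ω → ℝ) : Prop where
  measurable_arm : ∀ s, Measurable (A s)
  measurable_sample : ∀ s, Measurable (X s)
  cond_law : ∀ (s : ℕ) (G : Set (Fin s → Fin K × ℝ)), MeasurableSet G →
    ∀ (a : Fin K) (B : Set ℝ), MeasurableSet B →
      P {ω | history A X s ω ∈ G ∧ A s ω = a ∧ X s ω ∈ B} =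
        P {ω | history A X s ω ∈ G ∧ A s ω = a} * F.dist (μ a) B

/-- `N_a(t)`, the number of selections of arm `a` in the first `t` rounds. -/
def pulls (A : ℕ → Ω → Fin K) (a : Fin K) (t : ℕ) (ω : Ω) : ℕ :=
  ((Finset.range t).filter fun s => A s ω = a).card

/-- The empirical mean `μ̂_a(t)` (of no importance while `N_a(t) = 0`). -/
noncomputable def empMean (A : ℕ → Ω → Fin K) (X : ℕ → Ω → ℝ) (a : Fin K) (t : ℕ) (ω : Ω) : ℝ :=
  (∑ s ∈ (Finset.range t).filter (fun s => A s ω = a), X s ω) / (pulls A a t ω : ℝ)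

/-- `[N_a(t) d⁺(μ̂_a(t), θ) - 3 ln (1 + ln N_a(t))]⁺`; the truncated subtraction of `ℝ≥0∞` is the
positive part. It is `0` for an arm that has not been sampled. -/
noncomputable def evidence (F : ExpFamily) (A : ℕ → Ω → Fin K) (X : ℕ → Ω → ℝ) (t : ℕ) (ω : Ω)
    (a : Fin K) (θ : ℝ) : ℝ≥0∞ :=
  (pulls A a t ω : ℝ≥0∞) * F.divPlus (empMean A X a t ω) θ
    - ENNReal.ofReal (3 * Real.log (1 + Real.log (pulls A a t ω : ℝ)))

/-! ### Priors over subsets of arms, the confidence region, and the equation -/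

/-- A probability distribution over the subsets of the set of arms. -/
structure IsPrior (w : Finset (Fin K) → ℝ) : Prop where
  nonneg : ∀ S, 0 ≤ w S
  sum_eq_one : ∑ S, w S = 1

/-- `|S| 𝒯(ln (1 / (δ w(S))) / |S|)`, for `S` non-empty with `w(S) > 0`. -/
noncomputable def subsetThreshold (w : Finset (Fin K) → ℝ) (δ : ℝ) (S : Finset (Fin K)) : ℝ :=
  (S.card : ℝ) * threshold (Real.log (1 / (δ * w S)) / (S.card : ℝ))

/-- The one-sided confidence region at time `t`. Subsets with `w(S) = 0` have an infinite threshold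
and so impose nothing. -/
def confRegion (F : ExpFamily) (A : ℕ → Ω → Fin K) (X : ℕ → Ω → ℝ)
    (w : Finset (Fin K) → ℝ) (δ : ℝ) (t : ℕ) (ω : Ω) : Set (Fin K → ℝ) :=
  {lam | (∀ a, lam a ∈ F.means) ∧ ∀ S : Finset (Fin K), S.Nonempty → 0 < w S →
    ∑ a ∈ S, evidence F A X t ω a (lam a) ≤ ENNReal.ofReal (subsetThreshold w δ S)}

/-- The projection `{min_a lam_a : lam in the confidence region}`; its maximum is the projected upper
confidence bound on the minimum. -/
def projRegion (F : ExpFamily) (A : ℕ → Ω → Fin K) (X : ℕ → Ω → ℝ)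
    (w : Finset (Fin K) → ℝ) (δ : ℝ) (t : ℕ) (ω : Ω) : Set ℝ :=
  (fun lam : Fin K → ℝ => ⨅ a, lam a) '' confRegion F A X w δ t ω

/-- The left-hand side
`max_S [∑_{a ∈ S} [N_a(t) d⁺(μ̂_a(t), θ) - 3 ln (1 + ln N_a(t))]⁺ - |S| 𝒯(ln (1 / (δ w(S))) / |S|)]`
of the equation, over the non-empty `S`; a subset with `w(S) = 0` contributes `-∞` and is
left out. -/
noncomputable def objective (F : ExpFamily) (A : ℕ → Ω → Fin K) (X : ℕ → Ω → ℝ)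
    (w : Finset (Fin K) → ℝ) (δ : ℝ) (t : ℕ) (ω : Ω) (θ : ℝ) : EReal :=
  ⨆ (S : Finset (Fin K)) (_ : S.Nonempty) (_ : 0 < w S),
    (((∑ a ∈ S, evidence F A X t ω a θ : ℝ≥0∞) : EReal) - ((subsetThreshold w δ S : ℝ) : EReal))

/-- `θ` is a solution at time `t` of the equation, among the possible means. -/
def IsSolution (F : ExpFamily) (A : ℕ → Ω → Fin K) (X : ℕ → Ω → ℝ)
    (w : Finset (Fin K) → ℝ) (δ : ℝ) (t : ℕ) (ω : Ω) (θ : ℝ) : Prop :=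
  θ ∈ F.means ∧ objective F A X w δ t ω θ = 0

end Bandit

/-! The proof combines a probabilistic fact, that the vector of true means lies in the confidence
regions of all times with probability at least `1 - δ`, with a deterministic one, that a root of the
objective is the greatest element of the projected region.

Probabilistic part. Fix a subset `S`. For each arm take a mixture of likelihood ratios of
alternatives against the true natural parameter. Whatever the sampling rule, the product over `S` of
these mixtures is a martingale of initial value at most 1, so by Ville's inequality it ever reaches
`exp x` with probability at most `exp (-x)`. The mixture runs over geometric slices `z ^ i ≤ N < z ^
(i + 1)` of the sample count and over evidence levels `k`, spaced by `log 2`. Once the evidence of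
an arm passes level `m`, the components of all levels `k ≤ m` on the current slice are large, and
the weights are tuned so that the mixture is then at least `(1 / u) * 2 ^ ((1 - 1 / u) * m)`. Thus
the rescaled evidence is controlled like a sum of independent standard exponential variables, up to
a shift per arm; the Chernoff exponent `1 - 1 / u` is optimal when `h(u) = 1 + x / |S|`, which
produces the threshold (`IsBandit.measure_sum_evidence_le`). A union bound with failure
probabilities `δ * w S` concludes (`IsBandit.measure_mem_confRegion`).

Deterministic part. At a root `θ`, all constraints hold for the constant vector `θ`, and some
constraint is an equality. Raising every coordinate above `θ` would strictly increase the sum in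
that constraint, so no element of the region has a larger minimum (`IsSolution.iInf_le`,
`IsSolution.isGreatest`). Applied to the true means, this gives the coverage claim. Existence is the
intermediate value theorem in the natural parameter: the objective is continuous, and finite
evidence becomes arbitrarily small towards the left end of `Θ` (`exists_isSolution`). -/

/-! ### Likelihood ratios and divergences of an exponential family -/

namespace ExpFamily

variable (F : ExpFamily)

/-- The member of the family with natural parameter `η`. -/
noncomputable def law (η : ℝ) : Measure ℝ :=
  F.m.withDensity fun x => ENNReal.ofReal (Real.exp (x * η - F.b η))

/-- The log-likelihood ratio of the natural parameter `l` against `η`, at the observation `x`. -/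
noncomputable def logRatio (η l x : ℝ) : ℝ := (l - η) * x - (F.b l - F.b η)

lemma logRatio_self (η x : ℝ) : F.logRatio η η x = 0 := by simp [logRatio]

lemma convex_Θ : Convex ℝ F.Θ := F.strictConvexOn_b.1

lemma differentiableAt_b {η : ℝ} (h : η ∈ F.Θ) : DifferentiableAt ℝ F.b η :=
  (F.differentiableOn_b η h).differentiableAt (F.isOpen_Θ.mem_nhds h)

lemma continuousOn_deriv_b : ContinuousOn (deriv F.b) F.Θ :=
  F.differentiableOn_deriv_b.continuousOn

lemma strictMonoOn_deriv_b : StrictMonoOn (deriv F.b) F.Θ :=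
  F.strictConvexOn_b.strictMonoOn_deriv fun _ h => F.differentiableAt_b h

lemma natParam_mem {y : ℝ} (h : y ∈ F.means) : F.natParam y ∈ F.Θ :=
  Function.invFunOn_mem h

lemma deriv_natParam {y : ℝ} (h : y ∈ F.means) : deriv F.b (F.natParam y) = y :=
  Function.invFunOn_eq h

lemma deriv_mem_means {η : ℝ} (h : η ∈ F.Θ) : deriv F.b η ∈ F.means := ⟨η, h, rfl⟩

lemma natParam_deriv {η : ℝ} (h : η ∈ F.Θ) : F.natParam (deriv F.b η) = η :=
  F.strictMonoOn_deriv_b.injOn (F.natParam_mem (F.deriv_mem_means h)) h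
    (F.deriv_natParam (F.deriv_mem_means h))

lemma measurable_exp_logRatio (η l : ℝ) :
    Measurable fun x => ENNReal.ofReal (Real.exp (F.logRatio η l x)) := by
  unfold logRatio; fun_prop

lemma law_withDensity_logRatio (η l : ℝ) :
    (F.law η).withDensity (fun x => ENNReal.ofReal (Real.exp (F.logRatio η l x))) = F.law l := by
  unfold law
  rw [← withDensity_mul _ (by fun_prop) (F.measurable_exp_logRatio η l)]
  congr 1
  ext x
  simp only [Pi.mul_apply]
  rw [← ENNReal.ofReal_mul (Real.exp_pos _).le, ← Real.exp_add, logRatio]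
  congr 2
  ring

lemma law_univ {η : ℝ} (h : η ∈ F.Θ) : F.law η Set.univ = 1 := by
  rw [law, withDensity_apply _ MeasurableSet.univ, Measure.restrict_univ]
  exact F.lintegral_density η h

lemma isProbabilityMeasure_law {η : ℝ} (h : η ∈ F.Θ) : IsProbabilityMeasure (F.law η) :=
  ⟨F.law_univ h⟩

lemma lintegral_exp_logRatio (η : ℝ) {l : ℝ} (h : l ∈ F.Θ) :
    ∫⁻ x, ENNReal.ofReal (Real.exp (F.logRatio η l x)) ∂F.law η = 1 := by
  rw [← F.law_univ h, ← F.law_withDensity_logRatio η l, withDensity_apply _ MeasurableSet.univ,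
    Measure.restrict_univ]

lemma integrable_exp_logRatio (η : ℝ) {l : ℝ} (h : l ∈ F.Θ) :
    Integrable (fun x => Real.exp (F.logRatio η l x)) (F.law η) := by
  have hm : Measurable fun x => Real.exp (F.logRatio η l x) := by unfold logRatio; fun_prop
  refine ⟨hm.aestronglyMeasurable, ?_⟩
  rw [hasFiniteIntegral_iff_ofReal (Filter.Eventually.of_forall fun _ => (Real.exp_pos _).le),
    F.lintegral_exp_logRatio η h]
  exact ENNReal.one_lt_top

lemma integral_exp_logRatio (η : ℝ) {l : ℝ} (h : l ∈ F.Θ) :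
    ∫ x, Real.exp (F.logRatio η l x) ∂F.law η = 1 := by
  rw [integral_eq_lintegral_of_nonneg_ae
    (Filter.Eventually.of_forall fun _ => (Real.exp_pos _).le)
    (F.integrable_exp_logRatio η h).1, F.lintegral_exp_logRatio η h, ENNReal.toReal_one]

lemma exp_mul_eq (η s x : ℝ) :
    Real.exp (s * x) = Real.exp (F.b (η + s) - F.b η) * Real.exp (F.logRatio η (η + s) x) := by
  rw [← Real.exp_add, logRatio]
  congr 1
  ring

lemma mem_interior_integrableExpSet {η : ℝ} (h : η ∈ F.Θ) :
    0 ∈ interior (ProbabilityTheory.integrableExpSet id (F.law η)) := by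
  have hs : {s : ℝ | η + s ∈ F.Θ} ⊆ ProbabilityTheory.integrableExpSet id (F.law η) := by
    intro s hs
    have := (F.integrable_exp_logRatio η hs).const_mul (Real.exp (F.b (η + s) - F.b η))
    simpa only [ProbabilityTheory.integrableExpSet, Set.mem_ofPred_eq, id, F.exp_mul_eq η]
      using this
  refine interior_maximal hs (F.isOpen_Θ.preimage (continuous_const.add continuous_id)) ?_
  simpa using h

lemma integrable_id_law {η : ℝ} (h : η ∈ F.Θ) : Integrable (fun x : ℝ => x) (F.law η) :=
  ProbabilityTheory.integrable_of_mem_interior_integrableExpSet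
    (F.mem_interior_integrableExpSet h)

/-- Near 0 the cumulant generating function of the law is `s ↦ b (η + s) - b η`, and its derivative
at 0 is the mean. -/
lemma integral_id_law {η : ℝ} (h : η ∈ F.Θ) : ∫ x, x ∂F.law η = deriv F.b η := by
  have := F.isProbabilityMeasure_law h
  have h1 := ProbabilityTheory.deriv_cgf_zero (F.mem_interior_integrableExpSet h)
  have h2 : ProbabilityTheory.cgf id (F.law η) =ᶠ[nhds 0] fun s => F.b (η + s) - F.b η := by
    have : {s : ℝ | η + s ∈ F.Θ} ∈ nhds (0 : ℝ) :=
      (F.isOpen_Θ.preimage (continuous_const.add continuous_id)).mem_nhds (by simpa using h)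
    filter_upwards [this] with s hs
    have : ∫ x, Real.exp (s * x) ∂F.law η = Real.exp (F.b (η + s) - F.b η) := by
      simp only [F.exp_mul_eq η]
      rw [integral_const_mul, F.integral_exp_logRatio η hs, mul_one]
    simp only [ProbabilityTheory.cgf, ProbabilityTheory.mgf, id, this, Real.log_exp]
  rw [h2.deriv_eq, deriv_sub_const, deriv_comp_const_add] at h1
  simpa using h1.symm

lemma klDiv_law {η l : ℝ} (hη : η ∈ F.Θ) (hl : l ∈ F.Θ) :
    InformationTheory.klDiv (F.law l) (F.law η) =
      ENNReal.ofReal (F.logRatio η l (deriv F.b l)) := by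
  have := F.isProbabilityMeasure_law hη
  have := F.isProbabilityMeasure_law hl
  have hac : F.law l ≪ F.law η := by
    rw [← F.law_withDensity_logRatio η l]
    exact withDensity_absolutelyContinuous _ _
  have hrn : (F.law l).rnDeriv (F.law η) =ᵐ[F.law η]
      fun x => ENNReal.ofReal (Real.exp (F.logRatio η l x)) := by
    nth_rewrite 1 [← F.law_withDensity_logRatio η l]
    exact Measure.rnDeriv_withDensity _ (F.measurable_exp_logRatio η l)
  have hllr : llr (F.law l) (F.law η) =ᵐ[F.law l] F.logRatio η l := by
    filter_upwards [hac.ae_le hrn] with x hx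
    rw [llr, hx, ENNReal.toReal_ofReal (Real.exp_pos _).le, Real.log_exp]
  have hint := F.integrable_id_law hl
  have hint' : Integrable (F.logRatio η l) (F.law l) :=
    (hint.const_mul (l - η)).sub (integrable_const _)
  rw [InformationTheory.klDiv_of_ac_of_integrable hac (hint'.congr hllr.symm),
    integral_congr_ae hllr]
  have : ∫ x, F.logRatio η l x ∂F.law l = F.logRatio η l (deriv F.b l) := by
    unfold logRatio
    rw [integral_sub (hint.const_mul (l - η)) (integrable_const _), integral_const_mul,
      F.integral_id_law hl]
    simp
  rw [this]
  simp

/-! ### Convexity of `b` and the divergence as a supremum -/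

lemma tangent_le {η l : ℝ} (hη : η ∈ F.Θ) (hl : l ∈ F.Θ) :
    F.b η + deriv F.b η * (l - η) ≤ F.b l := by
  rcases lt_trichotomy η l with h | h | h
  · have := F.strictConvexOn_b.convexOn.deriv_le_slope hη hl h (F.differentiableAt_b hη)
    rw [slope_def_field, le_div_iff₀ (sub_pos.2 h)] at this
    linarith
  · simp [h]
  · have := F.strictConvexOn_b.convexOn.slope_le_deriv hl hη h (F.differentiableAt_b hη)
    rw [slope_def_field, div_le_iff₀ (sub_pos.2 h)] at this
    linarith

/-- The exponent `l x - b l` of the density at `x`. -/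
noncomputable def expo (x l : ℝ) : ℝ := l * x - F.b l

lemma logRatio_eq (η l x : ℝ) : F.logRatio η l x = F.expo x l - F.expo x η := by
  simp only [logRatio, expo]; ring

lemma expo_le_of_deriv_le {x η l : ℝ} (hη : η ∈ F.Θ) (hl : l ∈ F.Θ) (hx : deriv F.b η ≤ x)
    (h : l ≤ η) : F.expo x l ≤ F.expo x η := by
  have := F.tangent_le hη hl
  unfold expo
  nlinarith

lemma expo_le_of_le_deriv {x η l : ℝ} (hη : η ∈ F.Θ) (hl : l ∈ F.Θ) (hx : x ≤ deriv F.b η)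
    (h : η ≤ l) : F.expo x l ≤ F.expo x η := by
  have := F.tangent_le hη hl
  unfold expo
  nlinarith

lemma expo_lt_of_le_deriv {x η l : ℝ} (hη : η ∈ F.Θ) (hl : l ∈ F.Θ) (hx : x ≤ deriv F.b η)
    (h : η < l) : F.expo x l < F.expo x η := by
  -- Strictness comes from the midpoint: the slope of `b` there already exceeds `x`, so the second
  -- half of the path loses strictly.
  set z := (η + l) / 2 with hz
  have hzΘ : z ∈ F.Θ := F.convex_Θ.ordConnected.out hη hl ⟨by linarith, by linarith⟩
  have h1 := F.expo_le_of_le_deriv hη hzΘ hx (by linarith)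
  have h2 := F.tangent_le hzΘ hl
  have h3 := F.strictMonoOn_deriv_b hη hzΘ (by linarith)
  have h4 : F.expo x l < F.expo x z := by
    unfold expo
    nlinarith
  linarith

lemma continuousOn_expo (x : ℝ) : ContinuousOn (F.expo x) F.Θ :=
  (continuousOn_id.mul continuousOn_const).sub F.differentiableOn_b.continuousOn

/-- The supremum formula for the divergence holds on the whole line. -/
lemma div_deriv (x : ℝ) {η : ℝ} (hη : η ∈ F.Θ) :
    F.div x (deriv F.b η) = ⨆ l ∈ F.Θ, ENNReal.ofReal (F.expo x l - F.expo x η) := by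
  unfold div
  rw [F.natParam_deriv hη]
  split_ifs with hx
  · obtain ⟨l, hl, rfl⟩ := hx
    have : InformationTheory.klDiv (F.dist (deriv F.b l)) (F.dist (deriv F.b η)) =
        ENNReal.ofReal (F.logRatio η l (deriv F.b l)) := by
      rw [← F.klDiv_law hη hl]
      simp only [dist, law, F.natParam_deriv hη, F.natParam_deriv hl]
    rw [this, logRatio_eq]
    refine le_antisymm
      (le_iSup₂ (f := fun l' (_ : l' ∈ F.Θ) =>
        ENNReal.ofReal (F.expo (deriv F.b l) l' - F.expo (deriv F.b l) η)) l hl)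
      (iSup₂_le fun l' hl' => ENNReal.ofReal_le_ofReal ?_)
    have := F.tangent_le hl hl'
    unfold expo
    linarith
  · simp only [← F.logRatio_eq, logRatio]

/-- The one-sided divergence only involves alternatives with smaller natural parameters. -/
lemma exists_lt_logRatio {x η v : ℝ} (hη : η ∈ F.Θ) (hv : 0 ≤ v)
    (h : ENNReal.ofReal v < F.divPlus x (deriv F.b η)) :
    ∃ l ∈ F.Θ, l < η ∧ v < F.logRatio η l x := by
  unfold divPlus at h
  split_ifs at h with hx
  · rw [F.div_deriv x hη] at h
    obtain ⟨l, h⟩ := lt_iSup_iff.1 h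
    obtain ⟨hl, h⟩ := lt_iSup_iff.1 h
    have h' := (ENNReal.ofReal_lt_ofReal_iff_of_nonneg hv).1 h
    refine ⟨l, hl, ?_, by rwa [logRatio_eq]⟩
    by_contra hcon
    have := F.expo_le_of_le_deriv hη hl hx (not_lt.1 hcon)
    linarith
  · simp at h

/-- One sequence of alternatives detects all values at which the one-sided divergence
exceeds `v`. -/
lemma exists_seq_logRatio {η v : ℝ} (hη : η ∈ F.Θ) (hv : 0 ≤ v) :
    ∃ l : ℕ → ℝ, (∀ j, l j ∈ F.Θ) ∧ ∀ x, ENNReal.ofReal v < F.divPlus x (deriv F.b η) →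
      ∀ᶠ j in Filter.atTop, v < F.logRatio η (l j) x := by
  classical
  by_cases hne : ∃ l ∈ F.Θ, l < η
  · obtain ⟨l₀, hl₀, hlt₀⟩ := hne
    -- For `l < η` the ratio is decreasing in the observation, so each alternative detects exactly a
    -- half-line to the left of `c l`. Alternatives with `c l` approaching the supremum exhaust the
    -- union of these half-lines, even when no single one is best.
    let c : ℝ → EReal := fun l => (((F.b l - F.b η + v) / (l - η) : ℝ) : EReal)
    have hc : ∀ l < η, ∀ x : ℝ, v < F.logRatio η l x ↔ (x : EReal) < c l := by
      intro l hl x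
      simp only [c, EReal.coe_lt_coe_iff, logRatio]
      rw [lt_div_iff_of_neg (sub_neg.2 hl)]
      constructor <;> intro h <;> linarith
    obtain ⟨u, -, hu, huS⟩ := exists_seq_tendsto_sSup
      (S := c '' (F.Θ ∩ Set.Iio η)) ⟨_, l₀, ⟨hl₀, hlt₀⟩, rfl⟩ (OrderTop.bddAbove _)
    choose l hl hlu using huS
    refine ⟨l, fun j => (hl j).1, fun x hx => ?_⟩
    obtain ⟨l', hl', hlt', hx'⟩ := F.exists_lt_logRatio hη hv hx
    have : (x : EReal) < sSup (c '' (F.Θ ∩ Set.Iio η)) :=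
      ((hc l' hlt' x).1 hx').trans_le (le_sSup ⟨l', ⟨hl', hlt'⟩, rfl⟩)
    filter_upwards [hu.eventually (lt_mem_nhds this)] with j hj
    rw [hc _ (hl j).2, hlu]
    exact hj
  · refine ⟨fun _ => η, fun _ => hη, fun x hx => ?_⟩
    obtain ⟨l', hl', hlt', -⟩ := F.exists_lt_logRatio hη hv hx
    exact absurd ⟨l', hl', hlt'⟩ hne

/-! ### The one-sided divergence as a function of the natural parameter -/

lemma div_ge_of_mem (x : ℝ) {η l : ℝ} (hη : η ∈ F.Θ) (hl : l ∈ F.Θ) :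
    ENNReal.ofReal (F.expo x l - F.expo x η) ≤ F.div x (deriv F.b η) := by
  rw [F.div_deriv x hη]
  exact le_iSup₂ (f := fun l' (_ : l' ∈ F.Θ) => ENNReal.ofReal (F.expo x l' - F.expo x η)) l hl

/-- The divergence as the positive part of a difference, when it is finite. -/
lemma div_eq_of_isLUB {x C : ℝ} (hC : IsLUB (F.expo x '' F.Θ) C) {η : ℝ} (hη : η ∈ F.Θ) :
    F.div x (deriv F.b η) = ENNReal.ofReal (C - F.expo x η) := by
  rw [F.div_deriv x hη]
  refine le_antisymm (iSup₂_le fun l hl => ENNReal.ofReal_le_ofReal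
    (sub_le_sub_right (hC.1 ⟨l, hl, rfl⟩) _)) (le_of_forall_lt fun a ha => ?_)
  obtain ⟨r, hr0, har, hr⟩ := ENNReal.lt_iff_exists_real_btwn.1 ha
  have hr' := (ENNReal.ofReal_lt_ofReal_iff_of_nonneg hr0).1 hr
  obtain ⟨_, ⟨l, hl, rfl⟩, hlt⟩ := (lt_isLUB_iff hC).1 (show r + F.expo x η < C by linarith)
  exact har.trans_le ((ENNReal.ofReal_le_ofReal (by linarith)).trans
    (le_iSup₂ (f := fun l' (_ : l' ∈ F.Θ) => ENNReal.ofReal (F.expo x l' - F.expo x η)) l hl))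

lemma div_eq_top {x : ℝ} (hC : ¬ BddAbove (F.expo x '' F.Θ)) {η : ℝ} (hη : η ∈ F.Θ) :
    F.div x (deriv F.b η) = ⊤ := by
  by_contra h
  refine hC ⟨(F.div x (deriv F.b η)).toReal + F.expo x η, ?_⟩
  rintro _ ⟨l, hl, rfl⟩
  have := (ENNReal.ofReal_le_iff_le_toReal h).1 (F.div_ge_of_mem x hη hl)
  linarith

lemma exists_isLUB {x : ℝ} (hC : BddAbove (F.expo x '' F.Θ)) :
    ∃ C, IsLUB (F.expo x '' F.Θ) C :=
  ⟨_, isLUB_csSup (F.nonempty_Θ.image _) hC⟩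

lemma divPlus_le {x η η' : ℝ} (hη : η ∈ F.Θ) (hη' : η' ∈ F.Θ) (h : η ≤ η') :
    F.divPlus x (deriv F.b η) ≤ F.divPlus x (deriv F.b η') := by
  unfold divPlus
  split_ifs with h1 h2 h2
  · rw [F.div_deriv x hη, F.div_deriv x hη']
    refine iSup₂_mono fun l _ => ENNReal.ofReal_le_ofReal ?_
    linarith [F.expo_le_of_le_deriv hη hη' h1 h]
  · exact absurd (h1.trans (F.strictMonoOn_deriv_b.monotoneOn hη hη' h)) h2
  · exact zero_le
  · exact le_rfl

/-- A nonzero value places `x` at or below the mean, where the exponent is strictly decreasing in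
the parameter; finiteness makes the supremum a real constant that cancels. -/
lemma divPlus_lt {x η η' : ℝ} (hη : η ∈ F.Θ) (hη' : η' ∈ F.Θ) (h : η < η')
    (h0 : F.divPlus x (deriv F.b η) ≠ 0) (ht : F.divPlus x (deriv F.b η) ≠ ⊤) :
    F.divPlus x (deriv F.b η) < F.divPlus x (deriv F.b η') := by
  have hx : x ≤ deriv F.b η := by
    by_contra hx
    simp [divPlus, hx] at h0
  have hx' : x ≤ deriv F.b η' := hx.trans (F.strictMonoOn_deriv_b.monotoneOn hη hη' h.le)
  simp only [divPlus, hx, hx', if_true] at h0 ht ⊢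
  by_cases hb : BddAbove (F.expo x '' F.Θ)
  · obtain ⟨C, hC⟩ := F.exists_isLUB hb
    rw [F.div_eq_of_isLUB hC hη, F.div_eq_of_isLUB hC hη']
    have h1 := F.expo_lt_of_le_deriv hη hη' hx h
    have h2 := hC.1 ⟨η, hη, rfl⟩
    exact (ENNReal.ofReal_lt_ofReal_iff (by linarith)).2 (by linarith)
  · exact absurd (F.div_eq_top hb hη) ht

/-- The means form an interval. If `x` is one of them, the divergence vanishes at the cut-off, so
the indicator creates no jump. Otherwise `x` lies on one side of all means, and the indicator is
constant. -/
lemma continuousOn_divPlus (x : ℝ) :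
    ContinuousOn (fun η => F.divPlus x (deriv F.b η)) F.Θ := by
  by_cases hx : x ∈ F.means
  · obtain ⟨η₀, hη₀, rfl⟩ := hx
    have hC : IsLUB (F.expo (deriv F.b η₀) '' F.Θ) (F.expo (deriv F.b η₀) η₀) := by
      refine ⟨?_, fun u hu => hu ⟨η₀, hη₀, rfl⟩⟩
      rintro _ ⟨l, hl, rfl⟩
      rcases le_total l η₀ with h | h
      · exact F.expo_le_of_deriv_le hη₀ hl le_rfl h
      · exact F.expo_le_of_le_deriv hη₀ hl le_rfl h
    have hmax : ∀ η ∈ F.Θ, max η₀ η ∈ F.Θ := fun η hη => by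
      rcases max_choice η₀ η with h | h <;> rw [h] <;> assumption
    have heq : Set.EqOn (fun η => F.divPlus (deriv F.b η₀) (deriv F.b η)) (fun η =>
        ENNReal.ofReal (F.expo (deriv F.b η₀) η₀ - F.expo (deriv F.b η₀) (max η₀ η))) F.Θ := by
      intro η hη
      simp only [divPlus, F.strictMonoOn_deriv_b.le_iff_le hη₀ hη, F.div_eq_of_isLUB hC hη]
      split_ifs with h
      · rw [max_eq_right h]
      · rw [max_eq_left (not_le.1 h).le]; simp
    refine ContinuousOn.congr ?_ heq
    refine ENNReal.continuous_ofReal.comp_continuousOn (continuousOn_const.sub ?_)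
    exact (F.continuousOn_expo _).comp (continuous_const.max continuous_id).continuousOn hmax
  · by_cases hlt : ∃ η ∈ F.Θ, x ≤ deriv F.b η
    · obtain ⟨η₁, hη₁, h1⟩ := hlt
      have hall : ∀ η ∈ F.Θ, x ≤ deriv F.b η := by
        intro η hη
        by_contra hcon
        obtain ⟨l, hl, hlx⟩ := F.convex_Θ.isPreconnected.intermediate_value hη hη₁
          F.continuousOn_deriv_b ⟨(not_le.1 hcon).le, h1⟩
        exact hx ⟨l, hl, hlx⟩
      by_cases hb : BddAbove (F.expo x '' F.Θ)
      · obtain ⟨C, hC⟩ := F.exists_isLUB hb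
        refine ContinuousOn.congr (f := fun η => ENNReal.ofReal (C - F.expo x η)) ?_ fun η hη => by
          simp only [divPlus, hall η hη, if_true, F.div_eq_of_isLUB hC hη]
        exact ENNReal.continuous_ofReal.comp_continuousOn
          (continuousOn_const.sub (F.continuousOn_expo x))
      · refine ContinuousOn.congr (f := fun _ => ⊤) continuousOn_const fun η hη => by
          simp only [divPlus, hall η hη, if_true, F.div_eq_top hb hη]
    · push Not at hlt
      refine ContinuousOn.congr (f := fun _ => 0) continuousOn_const fun η hη => by
        simp only [divPlus, not_le.2 (hlt η hη), if_false]

/-- The one-sided divergence, if finite somewhere, is arbitrarily small towards the left. -/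
lemma exists_divPlus_le {x η₁ : ℝ} (hη₁ : η₁ ∈ F.Θ) (ht : F.divPlus x (deriv F.b η₁) ≠ ⊤)
    {ε : ℝ} (hε : 0 < ε) :
    ∃ η₀ ∈ F.Θ, ∀ η ∈ F.Θ, η ≤ η₀ → F.divPlus x (deriv F.b η) ≤ ENNReal.ofReal ε := by
  by_cases hlt : ∃ η ∈ F.Θ, deriv F.b η < x
  · obtain ⟨η₀, hη₀, h0⟩ := hlt
    refine ⟨η₀, hη₀, fun η hη h => ?_⟩
    have := (F.strictMonoOn_deriv_b.monotoneOn hη hη₀ h).trans_lt h0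
    simp [divPlus, not_le.2 this]
  · push Not at hlt
    have hb : BddAbove (F.expo x '' F.Θ) := by
      by_contra hb
      simp [divPlus, hlt η₁ hη₁, F.div_eq_top hb hη₁] at ht
    obtain ⟨C, hC⟩ := F.exists_isLUB hb
    obtain ⟨_, ⟨η₀, hη₀, rfl⟩, h0⟩ := (lt_isLUB_iff hC).1 (show C - ε < C by linarith)
    refine ⟨η₀, hη₀, fun η hη h => ?_⟩
    simp only [divPlus, hlt η hη, if_true, F.div_eq_of_isLUB hC hη]
    refine ENNReal.ofReal_le_ofReal ?_
    linarith [F.expo_le_of_le_deriv hη hη₀ (hlt η hη) h]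

end ExpFamily

/-! ### The threshold function -/

lemma strictMonoOn_hFun : StrictMonoOn hFun (Set.Ici 1) := by
  intro a ha b _ hab
  have ha' : (1 : ℝ) ≤ a := ha
  have h0 : 0 < a := by linarith
  have h1 : Real.log (b / a) < b / a - 1 :=
    Real.log_lt_sub_one_of_pos (div_pos (by linarith) h0) (by rw [ne_eq, div_eq_one_iff_eq h0.ne']; exact hab.ne')
  have h2 : b / a - 1 ≤ b - a := by
    rw [div_sub_one h0.ne', div_le_iff₀ h0]
    nlinarith
  rw [Real.log_div (by linarith) h0.ne'] at h1
  unfold hFun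
  linarith

lemma exists_hFun_eq {x : ℝ} (hx : 1 ≤ x) : ∃ u ∈ Set.Ici (1 : ℝ), hFun u = x := by
  have hc : ContinuousOn hFun (Set.Icc 1 (2 * x)) := by
    refine continuousOn_id.sub (Real.continuousOn_log.mono fun u hu => ?_)
    simp only [Set.mem_compl_iff, Set.mem_singleton_iff]
    linarith [hu.1]
  have h1 : hFun 1 ≤ x := by simpa [hFun] using hx
  have h2 : x ≤ hFun (2 * x) := by
    have h3 := Real.log_le_sub_one_of_pos (show 0 < x by linarith)
    have h4 := Real.log_two_lt_d9
    unfold hFun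
    rw [Real.log_mul two_ne_zero (by linarith)]
    linarith
  obtain ⟨u, hu, hux⟩ := intermediate_value_Icc (by linarith) hc ⟨h1, h2⟩
  exact ⟨u, hu.1, hux⟩

lemma one_le_hInv {x : ℝ} (hx : 1 ≤ x) : 1 ≤ hInv x :=
  Function.invFunOn_mem (exists_hFun_eq hx)

lemma hFun_hInv {x : ℝ} (hx : 1 ≤ x) : hFun (hInv x) = x :=
  Function.invFunOn_eq (exists_hFun_eq hx)

lemma log_three_halves_pos : 0 < Real.log (3 / 2) := Real.log_pos (by norm_num)

lemma log_three_halves_le : Real.log (3 / 2) ≤ 1 / 2 := by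
  have := Real.log_le_sub_one_of_pos (show (0 : ℝ) < 3 / 2 by norm_num)
  linarith

/-- The value of `h̃` is attained at some base `z`. -/
lemma exists_hTilde_eq {x : ℝ} (hx : 1 ≤ x) :
    ∃ z : ℝ, 1 < z ∧ z ≤ 3 / 2 ∧ hTilde (3 / 2) x = z * (x - Real.log (Real.log z)) := by
  unfold hTilde
  split_ifs with h
  · have hv1 := one_le_hInv hx
    have hv := hFun_hInv hx
    set v := hInv x
    have hv0 : 0 < v := by linarith
    have hle : 1 / Real.log (3 / 2) ≤ v := by
      rw [← strictMonoOn_hFun.le_iff_le _ hv1, hv]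
      · exact h
      · show 1 ≤ 1 / Real.log (3 / 2)
        rw [le_div_iff₀ log_three_halves_pos]
        linarith [log_three_halves_le]
    -- The base `z = exp (1 / v)` gives `log (log z) = -log v`, and `h v = x` turns `x + log v` into
    -- `v`.
    refine ⟨Real.exp (1 / v), ?_, ?_, ?_⟩
    · exact Real.one_lt_exp_iff.2 (by positivity)
    · rw [← Real.le_log_iff_exp_le (by norm_num), div_le_iff₀ hv0]
      rwa [div_le_iff₀' log_three_halves_pos] at hle
    · rw [Real.log_exp, one_div, Real.log_inv]
      unfold hFun at hv
      rw [show x - -Real.log v = v by linarith]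
  · exact ⟨3 / 2, by norm_num, le_rfl, rfl⟩

lemma hasSum_zetaTwo : HasSum (fun n : ℕ => 1 / ((n : ℝ) + 1) ^ 2) zetaTwo := by
  have := (summable_nat_add_iff 1).2 (Real.summable_one_div_nat_pow.2 one_lt_two)
  exact Summable.hasSum (by simpa using this)

lemma one_le_zetaTwo : 1 ≤ zetaTwo := by
  have := hasSum_zetaTwo.summable.le_tsum 0 fun n _ => by positivity
  simpa [zetaTwo] using this

lemma log_log_neg {z : ℝ} (h1 : 1 < z) (h2 : z ≤ 3 / 2) : Real.log (Real.log z) < 0 :=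
  Real.log_neg (Real.log_pos h1)
    (((Real.log_le_log (by linarith) h2).trans log_three_halves_le).trans_lt (by norm_num))

/-- The threshold as an affine function of `h⁻¹(1 + x)`, for a suitable base `z`. -/
lemma exists_threshold_eq {x : ℝ} (hx : 0 ≤ x) :
    ∃ z : ℝ, 1 < z ∧ z ≤ 3 / 2 ∧ threshold x = z * (hInv (1 + x) + Real.log 2 +
      (Real.log zetaTwo - 2 * Real.log (Real.log z))) := by
  have hu := one_le_hInv (show 1 ≤ 1 + x by linarith)
  have hz := one_le_zetaTwo
  have hlz := Real.log_nonneg hz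
  have hlog : Real.log (2 * zetaTwo) = Real.log 2 + Real.log zetaTwo :=
    Real.log_mul two_ne_zero (by linarith)
  -- This makes the argument of `hTilde` at least 1, where `hInv` is a genuine inverse; four terms
  -- of the series suffice, since `2 * 1.42 > e`.
  have hzeta : 1 ≤ Real.log 2 + Real.log zetaTwo := by
    have hsum := hasSum_zetaTwo.summable.sum_le_tsum (Finset.range 4) fun n _ => by positivity
    have h3 : (1.42 : ℝ) ≤ zetaTwo := by
      refine le_trans ?_ hsum
      norm_num [Finset.sum_range_succ]
    rw [← hlog, Real.le_log_iff_exp_le (by linarith)]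
    linarith [Real.exp_one_lt_d9]
  obtain ⟨z, h1, h2, h⟩ := exists_hTilde_eq
    (show 1 ≤ (hInv (1 + x) + Real.log (2 * zetaTwo)) / 2 by rw [hlog]; linarith)
  refine ⟨z, h1, h2, ?_⟩
  rw [threshold, h, hlog]
  ring

lemma threshold_pos {x : ℝ} (hx : 0 ≤ x) : 0 < threshold x := by
  obtain ⟨z, h1, h2, h⟩ := exists_threshold_eq hx
  have hu := one_le_hInv (show 1 ≤ 1 + x by linarith)
  have := log_log_neg h1 h2
  have := Real.log_nonneg one_le_zetaTwo
  have := Real.log_pos one_lt_two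
  rw [h]
  exact mul_pos (by linarith) (by linarith)

lemma log_one_div_pos {K : ℕ} {w : Finset (Fin K) → ℝ} (hw : IsPrior w) {δ : ℝ} (hδ0 : 0 < δ)
    (hδ1 : δ < 1) {S : Finset (Fin K)} (hS : 0 < w S) : 0 < Real.log (1 / (δ * w S)) := by
  have h1 : w S ≤ 1 := by
    rw [← hw.sum_eq_one]
    exact Finset.single_le_sum (fun T _ => hw.nonneg T) (Finset.mem_univ S)
  refine Real.log_pos ?_
  rw [lt_div_iff₀ (by positivity)]
  nlinarith

lemma subsetThreshold_pos {K : ℕ} {w : Finset (Fin K) → ℝ} (hw : IsPrior w) {δ : ℝ} (hδ0 : 0 < δ)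
    (hδ1 : δ < 1) {S : Finset (Fin K)} (hS : S.Nonempty) (hwS : 0 < w S) :
    0 < subsetThreshold w δ S := by
  have hc : (0 : ℝ) < S.card := by exact_mod_cast hS.card_pos
  exact mul_pos hc (threshold_pos (div_nonneg (log_one_div_pos hw hδ0 hδ1 hwS).le hc.le))

/-! ### A maximal inequality -/

/-- Ville's inequality for nonnegative supermartingales. -/
lemma measure_exists_ge_le {Ω : Type*} [m0 : MeasurableSpace Ω] (P : Measure Ω)
    (ℋ : ℕ → MeasurableSpace Ω) (hℋ : Monotone ℋ) (hle : ∀ t, ℋ t ≤ m0) (M : ℕ → Ω → ℝ≥0∞)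
    (hM : ∀ t, Measurable[ℋ t] (M t))
    (hsuper : ∀ t D, MeasurableSet[ℋ t] D → ∫⁻ ω in D, M (t + 1) ω ∂P ≤ ∫⁻ ω in D, M t ω ∂P)
    (h0 : ∫⁻ ω, M 0 ω ∂P ≤ 1) (c : ℝ≥0∞) :
    c * P {ω | ∃ t, c ≤ M t ω} ≤ 1 := by
  let D : ℕ → Set Ω := fun t => {ω | ∀ s < t, M s ω < c}
  let V : ℕ → Set Ω := fun t => {ω | c ≤ M t ω}
  have hV : ∀ t, MeasurableSet[ℋ t] (V t) := fun t => by
    let _ := ℋ t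
    exact measurableSet_le measurable_const (hM t)
  have hD : ∀ t, MeasurableSet[ℋ t] (D t) := fun t => by
    have : D t = ⋂ s ∈ Finset.range t, (V s)ᶜ := by
      ext ω
      simp [D, V]
    rw [this]
    let _ := ℋ t
    exact Finset.measurableSet_biInter _ fun s hs =>
      (hℋ (Finset.mem_range.1 hs).le _ (hV s)).compl
  have hsucc : ∀ t, D (t + 1) = D t \ V t := fun t => by
    ext ω
    simp only [D, V, Nat.lt_succ_iff, Set.mem_sdiff, Set.mem_ofPred_eq, not_le]
    exact ⟨fun h => ⟨fun s hs => h s hs.le, h t le_rfl⟩, fun h s hs =>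
      (lt_or_eq_of_le hs).elim (h.1 s) fun h' => h' ▸ h.2⟩
  -- This is the process stopped at its first crossing: paths that have crossed are charged `c`, the
  -- others their current value.
  have key : ∀ t, c * P (D t)ᶜ + ∫⁻ ω in D t, M t ω ∂P ≤ 1 := by
    intro t
    induction t with
    | zero => simpa [D] using h0
    | succ t ih =>
      refine le_trans ?_ ih
      have hVm := hle t _ (hV t)
      have hDm := hle t _ (hD t)
      have h1 : P (D (t + 1))ᶜ ≤ P (D t)ᶜ + P (D t ∩ V t) := by
        refine (measure_mono ?_).trans (measure_union_le _ _)
        rw [hsucc]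
        intro ω hω
        by_cases h : ω ∈ D t
        · exact Or.inr ⟨h, by_contra fun h' => hω ⟨h, h'⟩⟩
        · exact Or.inl h
      have h2 : c * P (D t ∩ V t) ≤ ∫⁻ ω in D t ∩ V t, M t ω ∂P := by
        rw [← setLIntegral_const]
        exact setLIntegral_mono' (hDm.inter hVm) fun ω hω => hω.2
      have h3 := hsuper t (D (t + 1)) (by
        rw [hsucc]
        let _ := ℋ t
        exact (hD t).diff (hV t))
      calc c * P (D (t + 1))ᶜ + ∫⁻ ω in D (t + 1), M (t + 1) ω ∂P
          ≤ c * (P (D t)ᶜ + P (D t ∩ V t)) + ∫⁻ ω in D (t + 1), M t ω ∂P := by gcongr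
        _ ≤ c * P (D t)ᶜ + (∫⁻ ω in D t ∩ V t, M t ω ∂P + ∫⁻ ω in D t \ V t, M t ω ∂P) := by
          rw [mul_add, add_assoc, hsucc]
          gcongr
        _ = c * P (D t)ᶜ + ∫⁻ ω in D t, M t ω ∂P := by
          rw [lintegral_inter_add_sdiff _ _ hVm]
  have hunion : {ω | ∃ t, c ≤ M t ω} = ⋃ t, (D t)ᶜ := by
    ext ω
    simp only [D, Set.mem_ofPred_eq, Set.mem_iUnion, Set.mem_compl_iff, not_forall, not_lt]
    exact ⟨fun ⟨t, h⟩ => ⟨t + 1, t, Nat.lt_succ_self t, h⟩, fun ⟨_, s, _, h⟩ => ⟨s, h⟩⟩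
  have hmono : Monotone fun t => (D t)ᶜ := fun s t hst =>
    Set.compl_subset_compl.2 fun ω hω r hr => hω r (hr.trans_le hst)
  rw [hunion, hmono.measure_iUnion, ENNReal.mul_iSup]
  exact iSup_le fun t => le_self_add.trans (key t)

/-- The event is an increasing union of tail intersections, each contained in some `E J`, so a
uniform bound survives without any summability. -/
lemma measure_eventually_le {Ω : Type*} [MeasurableSpace Ω] (P : Measure Ω) (E : ℕ → Set Ω)
    {c : ℝ≥0∞} (h : ∀ j, P (E j) ≤ c) : P {ω | ∀ᶠ j in Filter.atTop, ω ∈ E j} ≤ c := by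
  have : {ω | ∀ᶠ j in Filter.atTop, ω ∈ E j} = ⋃ J, ⋂ j ≥ J, E j := by
    ext ω
    simp [Filter.eventually_atTop]
  rw [this, Monotone.measure_iUnion]
  · exact iSup_le fun J => (measure_mono (Set.biInter_subset_of_mem (le_refl J))).trans (h J)
  · exact fun I J hIJ => Set.biInter_subset_biInter_left fun j hj => le_trans hIJ hj

/-! ### Likelihood ratios in a bandit model -/

section Bandit

variable {K : ℕ} {Ω : Type*}

/-- The information in the first `t` rounds. -/
abbrev historySpace (A : ℕ → Ω → Fin K) (X : ℕ → Ω → ℝ) (t : ℕ) : MeasurableSpace Ω :=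
  MeasurableSpace.comap (history A X t) inferInstance

variable {F : ExpFamily} {μ : Fin K → ℝ} {A : ℕ → Ω → Fin K} {X : ℕ → Ω → ℝ}

lemma IsBandit.measurable_history [MeasurableSpace Ω] {P : Measure Ω} (h : IsBandit F μ P A X) (t : ℕ) :
    Measurable (history A X t) :=
  measurable_pi_lambda _ fun i => (h.measurable_arm i).prodMk (h.measurable_sample i)

lemma IsBandit.historySpace_le [MeasurableSpace Ω] {P : Measure Ω} (h : IsBandit F μ P A X) (t : ℕ) :
    historySpace A X t ≤ ‹MeasurableSpace Ω› :=
  (h.measurable_history t).comap_le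

lemma measurable_round (A : ℕ → Ω → Fin K) (X : ℕ → Ω → ℝ) {s t : ℕ} (hst : s < t) :
    Measurable[historySpace A X t] fun ω => (A s ω, X s ω) := by
  have h1 : Measurable[historySpace A X t] (history A X t) := comap_measurable _
  exact (measurable_pi_apply (⟨s, hst⟩ : Fin t)).comp h1

lemma historySpace_mono (A : ℕ → Ω → Fin K) (X : ℕ → Ω → ℝ) : Monotone (historySpace A X) := by
  intro s t hst
  have : Measurable[historySpace A X t] (history A X s) := by
    let _ := historySpace A X t
    exact measurable_pi_lambda _ fun i => measurable_round A X (i.2.trans_le hst)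
  exact this.comap_le

/-- A sample is independent of the past, given the selected arm. -/
lemma IsBandit.lintegral_mul [MeasurableSpace Ω] {P : Measure Ω}
    [IsFiniteMeasure P] (h : IsBandit F μ P A X) (t : ℕ) (a : Fin K)
    (hμ : IsProbabilityMeasure (F.dist (μ a))) {f : Ω → ℝ≥0∞}
    (hf : Measurable[historySpace A X t] f) {r : ℝ → ℝ≥0∞} (hr : Measurable r) :
    ∫⁻ ω in {ω | A t ω = a}, f ω * r (X t ω) ∂P =
      (∫⁻ ω in {ω | A t ω = a}, f ω ∂P) * ∫⁻ x, r x ∂F.dist (μ a) := by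
  have hH := h.measurable_history t
  have hX := h.measurable_sample t
  have hA : MeasurableSet {ω | A t ω = a} := h.measurable_arm t (measurableSet_singleton a)
  obtain ⟨g, hg, rfl⟩ : ∃ g, Measurable g ∧ f = g ∘ history A X t := by
    obtain ⟨g, hg, hfg⟩ := Measurable.exists_eq_measurable_comp hf
    exact ⟨g, hg, hfg⟩
  have hprod : ((P.restrict {ω | A t ω = a}).map (history A X t)).prod (F.dist (μ a)) =
      (P.restrict {ω | A t ω = a}).map fun ω => (history A X t ω, X t ω) := by
    refine Measure.prod_eq fun G B hG hB => ?_
    rw [Measure.map_apply (hH.prodMk hX) (hG.prod hB), Measure.map_apply hH hG,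
      Measure.restrict_apply (hH.prodMk hX (hG.prod hB)), Measure.restrict_apply (hH hG)]
    have := h.cond_law t G hG a B hB
    convert this using 2
    · ext ω
      simp only [Set.mem_inter_iff, Set.mem_preimage, Set.mem_prod, Set.mem_ofPred_eq]
      tauto
    · rfl
  calc ∫⁻ ω in {ω | A t ω = a}, (g ∘ history A X t) ω * r (X t ω) ∂P
      = ∫⁻ p, g p.1 * r p.2 ∂(P.restrict {ω | A t ω = a}).map
          fun ω => (history A X t ω, X t ω) := by
        rw [lintegral_map (by fun_prop) (hH.prodMk hX)]
        rfl
    _ = _ := by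
        rw [← hprod, lintegral_prod_mul hg.aemeasurable hr.aemeasurable, lintegral_map hg hH]
        rfl

/-- The likelihood ratio, for the samples of arm `a`, of the natural parameter `l` against `η`. -/
noncomputable def likRatio (F : ExpFamily) (A : ℕ → Ω → Fin K) (X : ℕ → Ω → ℝ) (η : ℝ)
    (a : Fin K) (l : ℝ) (t : ℕ) (ω : Ω) : ℝ≥0∞ :=
  ∏ s ∈ Finset.range t,
    if A s ω = a then ENNReal.ofReal (Real.exp (F.logRatio η l (X s ω))) else 1

/-- A mixture of likelihood ratios with weights `q`. -/
noncomputable def mixRatio (F : ExpFamily) (A : ℕ → Ω → Fin K) (X : ℕ → Ω → ℝ) (η : ℝ)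
    (a : Fin K) {ι : Type*} (q : ι → ℝ≥0∞) (l : ι → ℝ) (t : ℕ) (ω : Ω) : ℝ≥0∞ :=
  ∑' i, q i * likRatio F A X η a (l i) t ω

lemma measurable_likRatio (η : ℝ) (a : Fin K) (l : ℝ) (t : ℕ) :
    Measurable[historySpace A X t] (likRatio F A X η a l t) := by
  let _ := historySpace A X t
  refine Finset.measurable_prod _ fun s hs => ?_
  have h := measurable_round A X (Finset.mem_range.1 hs)
  exact Measurable.ite (h.fst (measurableSet_singleton a))
    ((F.measurable_exp_logRatio η l).comp h.snd) measurable_const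

lemma measurable_mixRatio (η : ℝ) (a : Fin K) {ι : Type*} [Countable ι] (q : ι → ℝ≥0∞)
    (l : ι → ℝ) (t : ℕ) : Measurable[historySpace A X t] (mixRatio F A X η a q l t) := by
  let _ := historySpace A X t
  exact Measurable.tsum fun i => (measurable_likRatio η a (l i) t).const_mul _

lemma likRatio_succ (η : ℝ) (a : Fin K) (l : ℝ) (t : ℕ) (ω : Ω) :
    likRatio F A X η a l (t + 1) ω = likRatio F A X η a l t ω *
      if A t ω = a then ENNReal.ofReal (Real.exp (F.logRatio η l (X t ω))) else 1 := by
  rw [likRatio, Finset.prod_range_succ, likRatio]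

lemma mixRatio_succ_of_ne (η : ℝ) {a : Fin K} {ι : Type*} (q : ι → ℝ≥0∞) (l : ι → ℝ) (t : ℕ)
    {ω : Ω} (h : A t ω ≠ a) : mixRatio F A X η a q l (t + 1) ω = mixRatio F A X η a q l t ω := by
  simp [mixRatio, likRatio_succ, h]

/-- The product over arms of mixtures of likelihood ratios is a martingale. -/
lemma IsBandit.setLIntegral_prod_mixRatio [MeasurableSpace Ω] {P : Measure Ω}
    [IsFiniteMeasure P] (h : IsBandit F μ P A X)
    (hμ : ∀ a, μ a ∈ F.means) {ι : Type*} [Countable ι] (q : Fin K → ι → ℝ≥0∞)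
    (l : Fin K → ι → ℝ) (hl : ∀ a i, l a i ∈ F.Θ) (S : Finset (Fin K)) (t : ℕ) {D : Set Ω}
    (hD : MeasurableSet[historySpace A X t] D) :
    ∫⁻ ω in D, ∏ a ∈ S, mixRatio F A X (F.natParam (μ a)) a (q a) (l a) (t + 1) ω ∂P =
      ∫⁻ ω in D, ∏ a ∈ S, mixRatio F A X (F.natParam (μ a)) a (q a) (l a) t ω ∂P := by
  have hDm := h.historySpace_le t _ hD
  have hmem : ∀ a, MeasurableSet {ω | A t ω = a} := fun a =>
    h.measurable_arm t (measurableSet_singleton a)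
  have hsplit : ∀ f : Ω → ℝ≥0∞, ∫⁻ ω in D, f ω ∂P =
      ∑ c, ∫⁻ ω in {ω | A t ω = c}, D.indicator f ω ∂P := by
    intro f
    rw [← lintegral_indicator hDm, ← lintegral_biUnion_finset
      (fun a _ b _ hab => Set.disjoint_left.2 fun ω ha hb => hab (ha.symm.trans hb))
      fun a _ => hmem a]
    have : ⋃ c ∈ Finset.univ, {ω | A t ω = c} = Set.univ := by
      ext ω; simp
    rw [this, Measure.restrict_univ]
  rw [hsplit, hsplit]
  refine Finset.sum_congr rfl fun c _ => ?_
  set R := fun a => mixRatio F A X (F.natParam (μ a)) a (q a) (l a) with hR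
  by_cases hc : c ∈ S
  -- When arm `c` is selected, only its own factor changes. The rest is determined by the past and
  -- can be taken out, and the new likelihood ratio integrates to 1.
  · set f : Ω → ℝ≥0∞ := D.indicator fun ω => ∏ a ∈ S.erase c, R a t ω with hf
    have hfm : Measurable[historySpace A X t] f := by
      let _ := historySpace A X t
      exact (Finset.measurable_prod _ fun a _ => measurable_mixRatio _ _ _ _ _).indicator hD
    have hprob : IsProbabilityMeasure (F.dist (μ c)) :=
      F.isProbabilityMeasure_law (F.natParam_mem (hμ c))
    have hlik : ∀ i, Measurable[historySpace A X t]
        fun ω => f ω * (q c i * likRatio F A X (F.natParam (μ c)) c (l c i) t ω) := fun i => by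
      let _ := historySpace A X t
      exact hfm.mul ((measurable_likRatio _ _ _ _).const_mul _)
    have e1 : ∫⁻ ω in {ω | A t ω = c}, D.indicator (fun ω => ∏ a ∈ S, R a (t + 1) ω) ω ∂P =
        ∫⁻ ω in {ω | A t ω = c}, ∑' i,
          f ω * (q c i * likRatio F A X (F.natParam (μ c)) c (l c i) t ω) *
            ENNReal.ofReal (Real.exp (F.logRatio (F.natParam (μ c)) (l c i) (X t ω))) ∂P := by
      refine setLIntegral_congr_fun (hmem c) fun ω hω => ?_
      have hω' : A t ω = c := hω
      by_cases hωD : ω ∈ D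
      · simp only [hf, Set.indicator_of_mem hωD, mul_assoc]
        rw [ENNReal.tsum_mul_left, ← Finset.prod_erase_mul _ _ hc]
        congr 1
        · exact Finset.prod_congr rfl fun a ha => mixRatio_succ_of_ne _ _ _ _
            (hω'.trans_ne (Finset.ne_of_mem_erase ha).symm)
        · simp only [hR, mixRatio, likRatio_succ, hω', if_true]
      · simp [hf, hωD]
    have e2 : ∫⁻ ω in {ω | A t ω = c}, D.indicator (fun ω => ∏ a ∈ S, R a t ω) ω ∂P =
        ∫⁻ ω in {ω | A t ω = c}, ∑' i,
          f ω * (q c i * likRatio F A X (F.natParam (μ c)) c (l c i) t ω) ∂P := by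
      refine setLIntegral_congr_fun (hmem c) fun ω hω => ?_
      by_cases hωD : ω ∈ D
      · simp only [hf, Set.indicator_of_mem hωD]
        rw [ENNReal.tsum_mul_left, ← Finset.prod_erase_mul _ _ hc]
        rfl
      · simp [hf, hωD]
    rw [e1, e2, lintegral_tsum, lintegral_tsum]
    · refine tsum_congr fun i => ?_
      rw [h.lintegral_mul t c hprob (hlik i) (F.measurable_exp_logRatio _ _)]
      have : ∫⁻ x, ENNReal.ofReal (Real.exp (F.logRatio (F.natParam (μ c)) (l c i) x))
          ∂F.dist (μ c) = 1 := F.lintegral_exp_logRatio _ (hl c i)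
      rw [this, mul_one]
    · exact fun i => ((hlik i).mono (h.historySpace_le t) le_rfl).aemeasurable
    · exact fun i => (((hlik i).mono (h.historySpace_le t) le_rfl).mul
        ((F.measurable_exp_logRatio _ _).comp (h.measurable_sample t))).aemeasurable
  · refine setLIntegral_congr_fun (hmem c) fun ω hω => ?_
    have hω' : A t ω = c := hω
    by_cases hωD : ω ∈ D
    · simp only [Set.indicator_of_mem hωD]
      refine Finset.prod_congr rfl fun a ha => mixRatio_succ_of_ne _ _ _ _ ?_
      rw [hω']
      rintro rfl
      exact hc ha
    · simp [hωD]

lemma IsBandit.measure_prod_mixRatio_le [MeasurableSpace Ω] {P : Measure Ω}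
    [IsProbabilityMeasure P] (h : IsBandit F μ P A X)
    (hμ : ∀ a, μ a ∈ F.means) {ι : Type*} [Countable ι] (q : Fin K → ι → ℝ≥0∞)
    (hq : ∀ a, ∑' i, q a i ≤ 1) (l : Fin K → ι → ℝ) (hl : ∀ a i, l a i ∈ F.Θ)
    (S : Finset (Fin K)) (x : ℝ) :
    P {ω | ∃ t, ENNReal.ofReal (Real.exp x) ≤
        ∏ a ∈ S, mixRatio F A X (F.natParam (μ a)) a (q a) (l a) t ω} ≤
      ENNReal.ofReal (Real.exp (-x)) := by
  have := measure_exists_ge_le P (historySpace A X) (historySpace_mono A X) h.historySpace_le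
    (fun t ω => ∏ a ∈ S, mixRatio F A X (F.natParam (μ a)) a (q a) (l a) t ω)
    (fun t => by
      let _ := historySpace A X t
      exact Finset.measurable_prod _ fun a _ => measurable_mixRatio _ _ _ _ _)
    (fun t D hD => (h.setLIntegral_prod_mixRatio hμ q l hl S t hD).le)
    (by
      have h1 : ∀ ω, ∏ a ∈ S, mixRatio F A X (F.natParam (μ a)) a (q a) (l a) 0 ω ≤ 1 :=
        fun ω => Finset.prod_le_one' fun a _ => by simpa [mixRatio, likRatio] using hq a
      refine (lintegral_mono h1).trans ?_
      simp)
    (ENNReal.ofReal (Real.exp x))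
  rw [Real.exp_neg, ENNReal.ofReal_inv_of_pos (Real.exp_pos x), ← one_div,
    ENNReal.le_div_iff_mul_le (by simp [Real.exp_pos]) (by simp), mul_comm]
  exact this

lemma likRatio_eq (η : ℝ) (a : Fin K) (l : ℝ) {t : ℕ} {ω : Ω} (hN : 0 < pulls A a t ω) :
    likRatio F A X η a l t ω = ENNReal.ofReal (Real.exp
      (pulls A a t ω * F.logRatio η l (empMean A X a t ω))) := by
  have hN' : (pulls A a t ω : ℝ) ≠ 0 := by exact_mod_cast hN.ne'
  rw [likRatio, ← Finset.prod_filter, ← ENNReal.ofReal_prod_of_nonneg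
    fun _ _ => (Real.exp_pos _).le, ← Real.exp_sum]
  congr 2
  simp only [ExpFamily.logRatio, Finset.sum_sub_distrib, ← Finset.mul_sum, Finset.sum_const,
    nsmul_eq_mul, empMean]
  have hc : (((Finset.range t).filter fun s => A s ω = a).card : ℝ) = pulls A a t ω := rfl
  rw [hc]
  field_simp

end Bandit

/-! ### Weights and levels of the mixtures -/

/-- Weights for which `∑ k ≤ m, 2 ^ k * levelWeight β r k = β * r ^ m`. -/
noncomputable def levelWeight (β r : ℝ) : ℕ → ℝ
  | 0 => β
  | k + 1 => β * ((r - 1) / 2) * (r / 2) ^ k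

lemma levelWeight_nonneg {β r : ℝ} (hβ : 0 ≤ β) (hr : 1 ≤ r) (k : ℕ) : 0 ≤ levelWeight β r k := by
  cases k with
  | zero => exact hβ
  | succ k =>
    have : 0 ≤ r - 1 := by linarith
    have : 0 ≤ r := by linarith
    simp only [levelWeight]
    positivity

lemma sum_levelWeight (β r : ℝ) (m : ℕ) :
    ∑ k ∈ Finset.range (m + 1), levelWeight β r k * 2 ^ k = β * r ^ m := by
  induction m with
  | zero => simp [levelWeight]
  | succ m ih =>
    rw [Finset.sum_range_succ, ih, levelWeight, div_pow, pow_succ, pow_succ]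
    field_simp
    ring

/-- The tail is geometric with ratio `r / 2`, and the total mass is `β / (2 - r)`. -/
lemma tsum_levelWeight_le {β r : ℝ} (hβ : 0 ≤ β) (hr : 1 ≤ r) (hr2 : r < 2) (h : β ≤ 2 - r) :
    ∑' k, ENNReal.ofReal (levelWeight β r k) ≤ 1 := by
  have hs : HasSum (fun k => levelWeight β r (k + 1)) (β * ((r - 1) / 2) * (1 - r / 2)⁻¹) :=
    (hasSum_geometric_of_lt_one (by linarith) (by linarith)).mul_left _
  have hs' := (hasSum_nat_add_iff' (f := levelWeight β r)
    (g := levelWeight β r 0 + β * ((r - 1) / 2) * (1 - r / 2)⁻¹) 1).1 (by simpa using hs)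
  rw [← ENNReal.ofReal_tsum_of_nonneg (levelWeight_nonneg hβ hr) hs'.summable, hs'.tsum_eq,
    ENNReal.ofReal_le_one, levelWeight]
  have h2 : 0 < 2 - r := by linarith
  have : β + β * ((r - 1) / 2) * (1 - r / 2)⁻¹ = β / (2 - r) := by
    have : (1 - r / 2) = (2 - r) / 2 := by ring
    rw [this]
    field_simp
    ring
  rw [this, div_le_one h2]
  exact h

/-- Weights of the slices of the numbers of samples. -/
noncomputable def sliceWeight (i : ℕ) : ℝ := 1 / (zetaTwo * ((i : ℝ) + 1) ^ 2)

lemma sliceWeight_pos (i : ℕ) : 0 < sliceWeight i := by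
  have := one_le_zetaTwo
  unfold sliceWeight
  positivity

lemma tsum_sliceWeight : ∑' i, ENNReal.ofReal (sliceWeight i) = 1 := by
  have hz := one_le_zetaTwo
  have hs : HasSum sliceWeight 1 := by
    have := hasSum_zetaTwo.mul_left (1 / zetaTwo)
    rw [one_div_mul_cancel (by linarith)] at this
    exact this.congr_fun fun i => by rw [sliceWeight, one_div_mul_one_div]
  rw [← ENNReal.ofReal_tsum_of_nonneg (fun i => (sliceWeight_pos i).le) hs.summable, hs.tsum_eq,
    ENNReal.ofReal_one]

/-- The log-likelihood ratio required from level `k` on slice `i`. -/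
noncomputable def sliceLevel (k i : ℕ) : ℝ :=
  k * Real.log 2 + Real.log zetaTwo + 2 * Real.log ((i : ℝ) + 1)

lemma sliceLevel_nonneg (k i : ℕ) : 0 ≤ sliceLevel k i := by
  have h1 := Real.log_nonneg one_le_zetaTwo
  have h2 := Real.log_nonneg one_le_two
  have h3 : 0 ≤ Real.log ((i : ℝ) + 1) := Real.log_nonneg (by linarith [Nat.cast_nonneg (α := ℝ) i])
  unfold sliceLevel
  positivity

lemma sliceWeight_mul_exp (k i : ℕ) : sliceWeight i * Real.exp (sliceLevel k i) = 2 ^ k := by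
  have hz : 0 < zetaTwo := zero_lt_one.trans_le one_le_zetaTwo
  have hi : (0 : ℝ) < (i : ℝ) + 1 := by positivity
  have : sliceLevel k i = Real.log (2 ^ k * (zetaTwo * ((i : ℝ) + 1) ^ 2)) := by
    rw [Real.log_mul (by positivity) (by positivity), Real.log_mul hz.ne' (by positivity),
      Real.log_pow, Real.log_pow, sliceLevel]
    push_cast
    ring
  rw [this, Real.exp_log (by positivity), sliceWeight]
  field_simp

/-- Evidence may be infinite; truncating each term at `c + 1` keeps the sum above `c` and makes real
arithmetic possible. -/
lemma exists_real_lt_sum {α : Type*} (S : Finset α) (e : α → ℝ≥0∞) {c : ℝ}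
    (h : ENNReal.ofReal c < ∑ a ∈ S, e a) :
    ∃ x : α → ℝ, (∀ a, ENNReal.ofReal (x a) ≤ e a) ∧ c < ∑ a ∈ S, x a := by
  have hB : ∀ a, min (e a) (ENNReal.ofReal (c + 1)) ≠ ⊤ := fun a =>
    (min_le_right _ _).trans_lt ENNReal.ofReal_lt_top |>.ne
  refine ⟨fun a => (min (e a) (ENNReal.ofReal (c + 1))).toReal, fun a => ?_, ?_⟩
  · rw [ENNReal.ofReal_toReal (hB a)]
    exact min_le_left _ _
  · rw [← ENNReal.toReal_sum fun a _ => hB a]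
    rcases lt_or_ge c 0 with hc | hc
    · exact hc.trans_le ENNReal.toReal_nonneg
    rw [← ENNReal.ofReal_lt_iff_lt_toReal hc (ENNReal.sum_ne_top.2 fun a _ => hB a)]
    by_cases hle : ∀ a ∈ S, e a ≤ ENNReal.ofReal (c + 1)
    · rwa [Finset.sum_congr rfl fun a ha => min_eq_left (hle a ha)]
    · push Not at hle
      obtain ⟨a, ha, hlt⟩ := hle
      refine lt_of_lt_of_le ?_ (Finset.single_le_sum (fun _ _ => zero_le) ha)
      rw [min_eq_right hlt.le]
      exact (ENNReal.ofReal_lt_ofReal_iff (by linarith)).2 (by linarith)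

lemma exists_level {z c : ℝ} (hz : 0 < z) (x : ℝ) :
    ∃ m : ℕ, x ≤ z * ((m + 1) * Real.log 2 + c) ∧ (m = 0 ∨ z * (m * Real.log 2 + c) < x) := by
  have hl := Real.log_pos one_lt_two
  set y := (x / z - c) / Real.log 2 with hy
  have hxy : x = z * (y * Real.log 2 + c) := by
    rw [hy]
    field_simp
    ring
  -- The level is the largest integer strictly below `y`, so that the second inequality is strict;
  -- truncated subtraction yields level 0 when there is none.
  refine ⟨⌈y⌉₊ - 1, ?_, ?_⟩
  · have h1 : y ≤ ((⌈y⌉₊ - 1 : ℕ) : ℝ) + 1 := (Nat.le_ceil y).trans (by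
      exact_mod_cast (by omega : ⌈y⌉₊ ≤ ⌈y⌉₊ - 1 + 1))
    rw [hxy]
    gcongr
  · rcases Nat.eq_zero_or_pos (⌈y⌉₊ - 1) with h | h
    · exact Or.inl h
    · right
      have h1 : ((⌈y⌉₊ - 1 : ℕ) : ℝ) < y := Nat.lt_ceil.1 (by omega)
      rw [hxy]
      gcongr

/-! ### The deviation inequality -/

section Bandit

variable {K : ℕ} {Ω : Type*} {F : ExpFamily} {μ : Fin K → ℝ} {A : ℕ → Ω → Fin K} {X : ℕ → Ω → ℝ}

lemma pulls_pos_of_evidence {t : ℕ} {ω : Ω} {a : Fin K} {θ : ℝ}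
    (h : evidence F A X t ω a θ ≠ 0) : 0 < pulls A a t ω := by
  refine Nat.pos_of_ne_zero fun h0 => h ?_
  simp [evidence, h0]

/-- Within a slice, `N / z ^ i < z`, so replacing the sample count by its slice costs a factor `z`.
The weight of slice `i` costs `2 * log (i + 1)`, which is paid by the correction `3 * log (1 + log
N)`. -/
lemma divPlus_gt_of_evidence {t : ℕ} {ω : Ω} {a : Fin K} {θ z : ℝ} (h1 : 1 < z) (h2 : z ≤ 3 / 2)
    {i : ℕ} (hi1 : z ^ i ≤ pulls A a t ω) (hi2 : pulls A a t ω < z ^ (i + 1)) {k : ℕ}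
    (h : ENNReal.ofReal (z * (k * Real.log 2 +
      (Real.log zetaTwo - 2 * Real.log (Real.log z)))) < evidence F A X t ω a θ) :
    ENNReal.ofReal (sliceLevel k i / z ^ i) < F.divPlus (empMean A X a t ω) θ := by
  have hN := pulls_pos_of_evidence (ne_bot_of_gt h)
  set N := pulls A a t ω
  have hz0 : 0 < z := by linarith
  have hN1 : (1 : ℝ) ≤ N := by exact_mod_cast hN
  have hlz := Real.log_pos h1
  have hllz := log_log_neg h1 h2
  have hlN := Real.log_nonneg hN1
  have hL : 0 ≤ Real.log (1 + Real.log N) := Real.log_nonneg (by linarith)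
  have hzeta := Real.log_nonneg one_le_zetaTwo
  have hl2 := Real.log_nonneg one_le_two
  rw [evidence, lt_tsub_iff_right, ← ENNReal.ofReal_add
    (mul_nonneg hz0.le (by have : 0 ≤ (k : ℝ) * Real.log 2 := by positivity
                           linarith)) (by positivity)] at h
  have hi : Real.log ((i : ℝ) + 1) + Real.log (Real.log z) ≤ Real.log (1 + Real.log N) := by
    rw [← Real.log_mul (by positivity) hlz.ne']
    refine Real.log_le_log (by positivity) ?_
    have h3 := Real.log_le_log (by positivity) hi1
    rw [Real.log_pow] at h3
    have h4 := (Real.log_le_log hz0 h2).trans log_three_halves_le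
    linarith
  have hlevel : N * (sliceLevel k i / z ^ i) ≤ z * (k * Real.log 2 +
      (Real.log zetaTwo - 2 * Real.log (Real.log z))) + 3 * Real.log (1 + Real.log N) := by
    have h5 : N * (sliceLevel k i / z ^ i) ≤ z * sliceLevel k i := by
      rw [mul_div_assoc', div_le_iff₀ (by positivity)]
      have := mul_le_mul_of_nonneg_right hi2.le (sliceLevel_nonneg k i)
      rw [pow_succ] at this
      linarith
    have h6 : z * sliceLevel k i ≤ z * (k * Real.log 2 + Real.log zetaTwo +
        2 * (Real.log (1 + Real.log N) - Real.log (Real.log z))) := by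
      refine mul_le_mul_of_nonneg_left ?_ hz0.le
      unfold sliceLevel
      linarith
    -- The slice cost is multiplied by `2 * z ≤ 3`: this is why the base is at most `3 / 2`.
    nlinarith
  have h7 := (ENNReal.ofReal_le_ofReal hlevel).trans_lt h
  rw [ENNReal.ofReal_mul (by positivity), ENNReal.ofReal_natCast] at h7
  by_contra hcon
  exact absurd h7 (not_lt.2 (mul_le_mul_right (not_lt.1 hcon) _))

/-- On slice `i`, the weight times the ratio is at least `2 ^ k`, and the level weights sum these
powers to `β * r ^ m`. Level 0 has ratio 1 on all slices, so it contributes `β` even without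
samples. -/
lemma le_mixRatio {β r : ℝ} (hβ : 0 ≤ β) (hr : 1 ≤ r) {η : ℝ} {a : Fin K} {l : ℕ × ℕ → ℝ}
    {t : ℕ} {ω : Ω} {m i : ℕ} (h0 : ∀ i, l (0, i) = η)
    (h : ∀ k, 0 < k → k ≤ m →
      ENNReal.ofReal (Real.exp (sliceLevel k i)) ≤ likRatio F A X η a (l (k, i)) t ω) :
    ENNReal.ofReal (β * r ^ m) ≤ mixRatio F A X η a
      (fun p => ENNReal.ofReal (levelWeight β r p.1) * ENNReal.ofReal (sliceWeight p.2)) l t ω := by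
  rw [mixRatio, ENNReal.tsum_prod', ← sum_levelWeight, ENNReal.ofReal_sum_of_nonneg
    fun k _ => mul_nonneg (levelWeight_nonneg hβ hr k) (by positivity)]
  refine le_trans (Finset.sum_le_sum fun k hk => ?_) (ENNReal.sum_le_tsum (Finset.range (m + 1)))
  simp only [mul_assoc]
  rw [ENNReal.tsum_mul_left, ENNReal.ofReal_mul (levelWeight_nonneg hβ hr k)]
  refine mul_le_mul_right ?_ _
  rcases Nat.eq_zero_or_pos k with rfl | hk0
  · simp [h0, likRatio, F.logRatio_self, tsum_sliceWeight]
  · refine le_trans ?_ (ENNReal.le_tsum i)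
    rw [← sliceWeight_mul_exp k i, ENNReal.ofReal_mul (sliceWeight_pos i).le]
    exact mul_le_mul_right (h k hk0 (Nat.lt_succ_iff.1 (Finset.mem_range.1 hk))) _

/-- Time-uniform deviation inequality for the total evidence of a subset of the arms. -/
theorem IsBandit.measure_sum_evidence_le [MeasurableSpace Ω] {P : Measure Ω}
    [IsProbabilityMeasure P] (h : IsBandit F μ P A X) (hμ : ∀ a, μ a ∈ F.means)
    {S : Finset (Fin K)} (hS : S.Nonempty) {x : ℝ} (hx : 0 < x) :
    P {ω | ∃ t, ENNReal.ofReal (S.card * threshold (x / S.card)) <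
        ∑ a ∈ S, evidence F A X t ω a (μ a)} ≤ ENNReal.ofReal (Real.exp (-x)) := by
  have hn : (0 : ℝ) < S.card := by exact_mod_cast hS.card_pos
  have hxn : 0 < x / S.card := div_pos hx hn
  obtain ⟨z, hz1, hz2, hT⟩ := exists_threshold_eq hxn.le
  have hz0 : 0 < z := by linarith
  have hu1 := one_le_hInv (show 1 ≤ 1 + x / S.card by linarith)
  have hu := hFun_hInv (show 1 ≤ 1 + x / S.card by linarith)
  set u := hInv (1 + x / S.card)
  set c := Real.log zetaTwo - 2 * Real.log (Real.log z) with hc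
  have hu0 : 0 < u := by linarith
  have hulog : x / S.card = u - 1 - Real.log u := by
    unfold hFun at hu
    linarith
  have hl2 := Real.log_pos one_lt_two
  -- This maximises `lam * u + log (1 - lam)`, the Chernoff bound for a standard exponential
  -- variable at `u`.
  set lam := 1 - 1 / u with hlam
  have hlam0 : 0 ≤ lam := by
    rw [hlam, sub_nonneg, div_le_one hu0]
    exact hu1
  have hlam1 : lam < 1 := by
    have : 0 < 1 / u := by positivity
    linarith
  set r := (2 : ℝ) ^ lam with hr
  have hr1 : 1 ≤ r := Real.one_le_rpow one_le_two hlam0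
  have hr2 : r < 2 := by
    simpa using Real.rpow_lt_rpow_of_exponent_lt one_lt_two hlam1
  -- Bernoulli's inequality `2 ^ lam ≤ 1 + lam` keeps the total mass of the mixture at most 1.
  have hβr : 1 / u ≤ 2 - r := by
    have := rpow_one_add_le_one_add_mul_self (s := 1) (by norm_num) hlam0 hlam1.le
    rw [show (1 : ℝ) + 1 = 2 by norm_num] at this
    linarith
  have hβ : 0 ≤ 1 / u := by positivity
  choose L hLΘ hL using fun (a : Fin K) (p : ℕ × ℕ) =>
    F.exists_seq_logRatio (F.natParam_mem (hμ a))
      (div_nonneg (sliceLevel_nonneg p.1 p.2) (pow_nonneg hz0.le p.2))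
  let l : ℕ → Fin K → ℕ × ℕ → ℝ := fun j a p => if p.1 = 0 then F.natParam (μ a) else L a p j
  have hlΘ : ∀ j a p, l j a p ∈ F.Θ := fun j a p => by
    simp only [l]
    split_ifs
    · exact F.natParam_mem (hμ a)
    · exact hLΘ a p j
  let q : Fin K → ℕ × ℕ → ℝ≥0∞ := fun _ p =>
    ENNReal.ofReal (levelWeight (1 / u) r p.1) * ENNReal.ofReal (sliceWeight p.2)
  have hq : ∀ a, ∑' p, q a p ≤ 1 := fun a => by
    rw [ENNReal.tsum_prod']
    simp only [q, ENNReal.tsum_mul_left, tsum_sliceWeight, mul_one]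
    exact tsum_levelWeight_le hβ hr1 hr2 hβr
  -- Ville's inequality is applied for each fixed `j`; a deviation at `ω` forces a crossing for all
  -- large `j`.
  refine le_trans (measure_mono ?_) (measure_eventually_le P (fun j => {ω | ∃ t,
    ENNReal.ofReal (Real.exp x) ≤
      ∏ a ∈ S, mixRatio F A X (F.natParam (μ a)) a (q a) (l j a) t ω}) fun j =>
    h.measure_prod_mixRatio_le hμ q hq (l j) (hlΘ j) S x)
  rintro ω ⟨t, hω⟩
  obtain ⟨y, hy, hysum⟩ := exists_real_lt_sum S _ hω
  choose m hm1 hm2 using fun a => exists_level (c := c) hz0 (y a)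
  have harm : ∀ a, ∀ᶠ j in Filter.atTop, ENNReal.ofReal (1 / u * r ^ m a) ≤
      mixRatio F A X (F.natParam (μ a)) a (q a) (l j a) t ω := by
    intro a
    rcases hm2 a with h0 | hlt
    · refine Filter.Eventually.of_forall fun j => le_mixRatio (i := 0) hβ hr1 (by simp [l]) ?_
      intro k hk hk'
      omega
    · have hev : ENNReal.ofReal (z * (m a * Real.log 2 + c)) < evidence F A X t ω a (μ a) := by
        refine lt_of_lt_of_le ((ENNReal.ofReal_lt_ofReal_iff_of_nonneg ?_).2 hlt) (hy a)
        have := Real.log_nonneg one_le_zetaTwo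
        have := log_log_neg hz1 hz2
        have : 0 ≤ (m a : ℝ) * Real.log 2 := by positivity
        exact mul_nonneg hz0.le (by linarith)
      have hN := pulls_pos_of_evidence (ne_bot_of_gt hev)
      obtain ⟨i, hi1, hi2⟩ := exists_nat_pow_near
        (show (1 : ℝ) ≤ pulls A a t ω by exact_mod_cast hN) hz1
      have hall : ∀ᶠ j in Filter.atTop, ∀ k ∈ Finset.range (m a + 1),
          sliceLevel k i / z ^ i < F.logRatio (F.natParam (μ a)) (L a (k, i) j)
            (empMean A X a t ω) := by
        rw [Filter.eventually_all_finset]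
        intro k hk
        refine hL a (k, i) _ ?_
        rw [F.deriv_natParam (hμ a)]
        refine divPlus_gt_of_evidence hz1 hz2 hi1 hi2 (lt_of_le_of_lt ?_ hev)
        refine ENNReal.ofReal_le_ofReal (mul_le_mul_of_nonneg_left ?_ hz0.le)
        have : (k : ℝ) ≤ m a := by exact_mod_cast Nat.lt_succ_iff.1 (Finset.mem_range.1 hk)
        gcongr
      filter_upwards [hall] with j hj
      refine le_mixRatio (i := i) hβ hr1 (by simp [l]) fun k hk hk' => ?_
      rw [likRatio_eq _ _ _ hN]
      refine ENNReal.ofReal_le_ofReal (Real.exp_le_exp.2 ?_)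
      have hlt' := hj k (Finset.mem_range.2 (Nat.lt_succ_iff.2 hk'))
      simp only [l, hk.ne', if_false]
      have hzi : 0 < z ^ i := by positivity
      have h8 := (div_lt_iff₀ hzi).1 hlt'
      have h9 : 0 ≤ sliceLevel k i / z ^ i := div_nonneg (sliceLevel_nonneg k i) hzi.le
      nlinarith
  -- Rounding down to levels loses at most `log 2` per arm before the factor `z`, which is the `log
  -- 2` in the threshold.
  have hsum : S.card * u ≤ (∑ a ∈ S, (m a : ℝ)) * Real.log 2 := by
    have h1 : ∑ a ∈ S, y a ≤ ∑ a ∈ S, z * ((m a + 1) * Real.log 2 + c) :=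
      Finset.sum_le_sum fun a _ => hm1 a
    have h2 : ∑ a ∈ S, z * ((m a + 1) * Real.log 2 + c) =
        z * ((∑ a ∈ S, (m a : ℝ)) * Real.log 2 + S.card * (Real.log 2 + c)) := by
      rw [← Finset.mul_sum, Finset.sum_add_distrib, ← Finset.sum_mul, Finset.sum_add_distrib]
      simp only [Finset.sum_const, nsmul_eq_mul]
      ring
    rw [hT] at hysum
    have h3 : z * (S.card * (u + Real.log 2 + c)) <
        z * ((∑ a ∈ S, (m a : ℝ)) * Real.log 2 + S.card * (Real.log 2 + c)) := by linarith
    have h4 := lt_of_mul_lt_mul_left h3 hz0.le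
    linarith
  have hprod : Real.exp x ≤ ∏ a ∈ S, (1 / u * r ^ m a) := by
    have h1 : ∀ a, 1 / u * r ^ m a = Real.exp (-Real.log u + lam * Real.log 2 * m a) := by
      intro a
      rw [Real.exp_add, Real.exp_neg, Real.exp_log hu0, one_div, hr,
        Real.rpow_def_of_pos two_pos, ← Real.exp_nat_mul]
      congr 2
      ring
    rw [Finset.prod_congr rfl fun a _ => h1 a, ← Real.exp_sum, Real.exp_le_exp,
      Finset.sum_add_distrib, ← Finset.mul_sum, Finset.sum_const, nsmul_eq_mul]
    have h2 : x = S.card * (u - 1 - Real.log u) := by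
      rw [← hulog, mul_div_cancel₀ _ hn.ne']
    have h3 := mul_le_mul_of_nonneg_left hsum hlam0
    have h4 : lam * u = u - 1 := by
      rw [hlam, sub_mul, one_mul, one_div_mul_cancel hu0.ne']
    have h5 : lam * (S.card * u) = S.card * (u - 1) := by rw [← h4]; ring
    linarith
  have hall : ∀ᶠ j in Filter.atTop, ∀ a ∈ S, ENNReal.ofReal (1 / u * r ^ m a) ≤
      mixRatio F A X (F.natParam (μ a)) a (q a) (l j a) t ω :=
    (Filter.eventually_all_finset S).2 fun a _ => harm a
  filter_upwards [hall] with j hj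
  refine ⟨t, (ENNReal.ofReal_le_ofReal hprod).trans ?_⟩
  rw [ENNReal.ofReal_prod_of_nonneg fun a _ => by positivity]
  exact Finset.prod_le_prod' hj

end Bandit

/-! ### The equation and the confidence region -/

section Bandit

variable {K : ℕ} {Ω : Type*} {F : ExpFamily} {A : ℕ → Ω → Fin K} {X : ℕ → Ω → ℝ}
  {w : Finset (Fin K) → ℝ} {δ : ℝ} {t : ℕ} {ω : Ω}

lemma evidence_le {a : Fin K} {η η' : ℝ} (hη : η ∈ F.Θ) (hη' : η' ∈ F.Θ) (h : η ≤ η') :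
    evidence F A X t ω a (deriv F.b η) ≤ evidence F A X t ω a (deriv F.b η') := by
  unfold evidence
  have := F.divPlus_le (x := empMean A X a t ω) hη hη' h
  gcongr

lemma evidence_lt {a : Fin K} {η η' : ℝ} (hη : η ∈ F.Θ) (hη' : η' ∈ F.Θ) (h : η < η')
    (h0 : evidence F A X t ω a (deriv F.b η) ≠ 0)
    (ht : evidence F A X t ω a (deriv F.b η) ≠ ⊤) :
    evidence F A X t ω a (deriv F.b η) < evidence F A X t ω a (deriv F.b η') := by
  have hN := pulls_pos_of_evidence h0
  have hN0 : (pulls A a t ω : ℝ≥0∞) ≠ 0 := by exact_mod_cast hN.ne'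
  unfold evidence at h0 ht ⊢
  have hlt := tsub_pos_iff_lt.1 (pos_iff_ne_zero.2 h0)
  have hd0 : F.divPlus (empMean A X a t ω) (deriv F.b η) ≠ 0 := by
    intro hd
    simp [hd] at h0
  have hdt : F.divPlus (empMean A X a t ω) (deriv F.b η) ≠ ⊤ := by
    intro hd
    rw [hd, ENNReal.mul_top hN0, ENNReal.top_sub ENNReal.ofReal_ne_top] at ht
    exact ht rfl
  refine ENNReal.cancel_of_ne ENNReal.ofReal_ne_top |>.tsub_lt_tsub_right_of_le hlt.le ?_
  exact ENNReal.mul_lt_mul_right hN0 (ENNReal.natCast_ne_top _) (F.divPlus_lt hη hη' h hd0 hdt)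

lemma continuousOn_evidence (a : Fin K) :
    ContinuousOn (fun η => evidence F A X t ω a (deriv F.b η)) F.Θ := by
  unfold evidence
  exact (ENNReal.continuous_sub_right _).comp_continuousOn
    ((ENNReal.continuous_const_mul (ENNReal.natCast_ne_top _)).comp_continuousOn
      (F.continuousOn_divPlus _))

lemma exists_evidence_le {a : Fin K} {η₁ : ℝ} (hη₁ : η₁ ∈ F.Θ)
    (ht : evidence F A X t ω a (deriv F.b η₁) ≠ ⊤) {ε : ℝ} (hε : 0 < ε) :
    ∃ η₀ ∈ F.Θ, ∀ η ∈ F.Θ, η ≤ η₀ →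
      evidence F A X t ω a (deriv F.b η) ≤ ENNReal.ofReal ε := by
  rcases Nat.eq_zero_or_pos (pulls A a t ω) with hN | hN
  · exact ⟨η₁, hη₁, fun η _ _ => by simp [evidence, hN]⟩
  have hN0 : (pulls A a t ω : ℝ≥0∞) ≠ 0 := by exact_mod_cast hN.ne'
  have hN' : (0 : ℝ) < pulls A a t ω := by exact_mod_cast hN
  have hdt : F.divPlus (empMean A X a t ω) (deriv F.b η₁) ≠ ⊤ := by
    intro hd
    rw [evidence, hd, ENNReal.mul_top hN0, ENNReal.top_sub ENNReal.ofReal_ne_top] at ht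
    exact ht rfl
  obtain ⟨η₀, hη₀, h⟩ := F.exists_divPlus_le hη₁ hdt (div_pos hε hN')
  refine ⟨η₀, hη₀, fun η hη hle => tsub_le_self.trans ?_⟩
  calc (pulls A a t ω : ℝ≥0∞) * F.divPlus (empMean A X a t ω) (deriv F.b η)
      ≤ pulls A a t ω * ENNReal.ofReal (ε / pulls A a t ω) := by
        gcongr
        exact h η hη hle
    _ = ENNReal.ofReal ε := by
        rw [← ENNReal.ofReal_natCast, ← ENNReal.ofReal_mul hN'.le, mul_div_cancel₀ _ hN'.ne']

lemma coe_sub_nonpos_iff {e : ℝ≥0∞} {c : ℝ} (hc : 0 < c) :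
    (e : EReal) - (c : EReal) ≤ 0 ↔ e ≤ ENNReal.ofReal c := by
  rw [EReal.sub_nonpos, ← EReal.coe_ennreal_le_coe_ennreal_iff, EReal.coe_ennreal_ofReal,
    max_eq_left hc.le]

lemma objective_le_zero_iff (hw : IsPrior w) (hδ0 : 0 < δ) (hδ1 : δ < 1) {θ : ℝ} :
    objective F A X w δ t ω θ ≤ 0 ↔ ∀ S : Finset (Fin K), S.Nonempty → 0 < w S →
      ∑ a ∈ S, evidence F A X t ω a θ ≤ ENNReal.ofReal (subsetThreshold w δ S) := by
  unfold objective
  simp only [iSup_le_iff]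
  exact forall_congr' fun S => forall₂_congr fun hS hwS =>
    coe_sub_nonpos_iff (subsetThreshold_pos hw hδ0 hδ1 hS hwS)

/-- A maximum over finitely many subsets is attained, and excluded subsets contribute `⊥ < 0`, so a
zero value must come from an admissible one. -/
lemma exists_sum_evidence_eq (hw : IsPrior w) (hδ0 : 0 < δ) (hδ1 : δ < 1) {θ : ℝ}
    (h : objective F A X w δ t ω θ = 0) : ∃ S : Finset (Fin K), S.Nonempty ∧ 0 < w S ∧
      ∑ a ∈ S, evidence F A X t ω a θ = ENNReal.ofReal (subsetThreshold w δ S) := by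
  have hle := (objective_le_zero_iff hw hδ0 hδ1).1 h.le
  by_contra hcon
  push Not at hcon
  have hlt : objective F A X w δ t ω θ < 0 := by
    unfold objective
    rw [← Finset.sup_univ_eq_iSup, Finset.sup_lt_iff EReal.bot_lt_zero]
    intro S _
    by_cases hS : S.Nonempty
    · by_cases hwS : 0 < w S
      · simp only [hS, hwS, iSup_pos]
        refine lt_of_le_of_ne ((coe_sub_nonpos_iff
          (subsetThreshold_pos hw hδ0 hδ1 hS hwS)).2 (hle S hS hwS)) fun heq => ?_
        have h1 : 0 ≤ ((∑ a ∈ S, evidence F A X t ω a θ : ℝ≥0∞) : EReal) -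
          ((subsetThreshold w δ S : ℝ) : EReal) := heq.ge
        rw [EReal.sub_nonneg (by simp) (by simp)] at h1
        refine hcon S hS hwS (le_antisymm (hle S hS hwS) ?_)
        rwa [← EReal.coe_ennreal_le_coe_ennreal_iff, EReal.coe_ennreal_ofReal,
          max_eq_left (subsetThreshold_pos hw hδ0 hδ1 hS hwS).le]
      · simp [hwS]
    · simp [hS]
  exact hlt.ne h

/-- A solution bounds the minimum of every element of the confidence region. -/
lemma IsSolution.iInf_le (hw : IsPrior w) (hδ0 : 0 < δ) (hδ1 : δ < 1) {θ : ℝ}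
    (h : IsSolution F A X w δ t ω θ) {lam : Fin K → ℝ}
    (hlam : lam ∈ confRegion F A X w δ t ω) : ⨅ a, lam a ≤ θ := by
  obtain ⟨⟨η, hη, rfl⟩, hobj⟩ := h
  obtain ⟨S, hS, hwS, heq⟩ := exists_sum_evidence_eq hw hδ0 hδ1 hobj
  by_contra hcon
  have hlt : ∀ a, deriv F.b η < lam a := fun a =>
    (not_le.1 hcon).trans_le (ciInf_le (Set.finite_range lam).bddBelow a)
  choose l hl hlb using hlam.1
  have hltl : ∀ a, η < l a := fun a =>
    (F.strictMonoOn_deriv_b.lt_iff_lt hη (hl a)).1 (by rw [hlb]; exact hlt a)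
  -- The binding threshold is positive and finite. Hence some arm of `S` has nonzero, finite
  -- evidence, which is what strict monotonicity requires.
  have hpos : ∑ a ∈ S, evidence F A X t ω a (deriv F.b η) ≠ 0 := by
    rw [heq]
    exact (ENNReal.ofReal_pos.2 (subsetThreshold_pos hw hδ0 hδ1 hS hwS)).ne'
  have hfin : ∑ a ∈ S, evidence F A X t ω a (deriv F.b η) ≠ ⊤ := by
    rw [heq]
    exact ENNReal.ofReal_ne_top
  obtain ⟨a, ha, ha0⟩ : ∃ a ∈ S, evidence F A X t ω a (deriv F.b η) ≠ 0 := by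
    by_contra hall
    push Not at hall
    exact hpos (Finset.sum_eq_zero hall)
  have hat := ENNReal.sum_ne_top.1 hfin
  have hsum : ∑ a ∈ S, evidence F A X t ω a (deriv F.b η) <
      ∑ a ∈ S, evidence F A X t ω a (lam a) := by
    rw [← Finset.add_sum_erase _ _ ha, ← Finset.add_sum_erase S
      (fun a => evidence F A X t ω a (lam a)) ha]
    refine ENNReal.add_lt_add_of_lt_of_le
      (ENNReal.sum_ne_top.2 fun c hc => hat c (Finset.mem_of_mem_erase hc)) ?_
      (Finset.sum_le_sum fun c _ => ?_)
    · rw [← hlb a]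
      exact evidence_lt hη (hl a) (hltl a) ha0 (hat a ha)
    · rw [← hlb c]
      exact evidence_le hη (hl c) (hltl c).le
  exact absurd (hlam.2 S hS hwS) (not_le.2 (heq ▸ hsum))

lemma IsSolution.isGreatest (hw : IsPrior w) (hδ0 : 0 < δ) (hδ1 : δ < 1) {θ : ℝ}
    (h : IsSolution F A X w δ t ω θ) : IsGreatest (projRegion F A X w δ t ω) θ := by
  refine ⟨⟨fun _ => θ, ⟨fun _ => h.1, (objective_le_zero_iff hw hδ0 hδ1).1 h.2.le⟩, ?_⟩, ?_⟩
  · obtain ⟨S, ⟨a, -⟩, -⟩ := exists_sum_evidence_eq hw hδ0 hδ1 h.2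
    have : Nonempty (Fin K) := ⟨a⟩
    exact ciInf_const
  · rintro _ ⟨lam, hlam, rfl⟩
    exact h.iInf_le hw hδ0 hδ1 hlam

/-! ### Existence of a solution -/

lemma continuousOn_objective :
    ContinuousOn (fun η => objective F A X w δ t ω (deriv F.b η)) F.Θ := by
  have hS : ∀ S : Finset (Fin K), ContinuousOn (fun η =>
      ⨆ (_ : S.Nonempty) (_ : 0 < w S),
        (((∑ a ∈ S, evidence F A X t ω a (deriv F.b η) : ℝ≥0∞) : EReal) -
          ((subsetThreshold w δ S : ℝ) : EReal))) F.Θ := by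
    intro S
    by_cases hS : S.Nonempty
    · by_cases hwS : 0 < w S
      · simp only [hS, hwS, iSup_pos]
        have h1 : ContinuousOn (fun η =>
            ((∑ a ∈ S, evidence F A X t ω a (deriv F.b η) : ℝ≥0∞) : EReal)) F.Θ :=
          continuous_coe_ennreal_ereal.comp_continuousOn
            (continuousOn_finsetSum S fun a _ => continuousOn_evidence a)
        intro η hη
        have h2 := EReal.continuousAt_add
          (p := (((∑ a ∈ S, evidence F A X t ω a (deriv F.b η) : ℝ≥0∞) : EReal),
            -((subsetThreshold w δ S : ℝ) : EReal))) (Or.inr (by simp)) (Or.inl (by simp))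
        exact ContinuousAt.comp_continuousWithinAt
          (f := fun η => (((∑ a ∈ S, evidence F A X t ω a (deriv F.b η) : ℝ≥0∞) : EReal),
            -((subsetThreshold w δ S : ℝ) : EReal))) h2 ((h1 η hη).prodMk continuousWithinAt_const)
      · simpa [hwS] using continuousOn_const
    · simpa [hS] using continuousOn_const
  have := ContinuousOn.finset_sup (s := Finset.univ) fun S _ => hS S
  refine this.congr fun η _ => ?_
  rw [Finset.sup_apply, Finset.sup_univ_eq_iSup]
  rfl

lemma exists_isSolution (hw : IsPrior w) (hδ0 : 0 < δ) (hδ1 : δ < 1)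
    (h : ∃ θ₁ ∈ F.means, 0 ≤ objective F A X w δ t ω θ₁ ∧ objective F A X w δ t ω θ₁ ≠ ⊤) :
    ∃ θ, IsSolution F A X w δ t ω θ := by
  obtain ⟨_, ⟨η₁, hη₁, rfl⟩, h0, htop⟩ := h
  have hfin : ∀ S : Finset (Fin K), S.Nonempty → 0 < w S → ∀ a ∈ S,
      evidence F A X t ω a (deriv F.b η₁) ≠ ⊤ := by
    intro S hS hwS a ha hat
    refine htop (top_le_iff.1 ?_)
    refine le_trans ?_ (le_iSup_of_le S (le_iSup₂_of_le hS hwS le_rfl))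
    have : ∑ a ∈ S, evidence F A X t ω a (deriv F.b η₁) = ⊤ := ENNReal.sum_eq_top.2 ⟨a, ha, hat⟩
    rw [this]
    simp
  have : Nonempty F.Θ := ⟨⟨η₁, hη₁⟩⟩
  -- Finiteness of the objective makes all relevant evidence finite, hence small far to the left.
  -- Giving each arm an equal share of the threshold makes every constraint hold.
  have hev : ∀ᶠ η : F.Θ in Filter.atBot, ∀ S : Finset (Fin K), S.Nonempty → 0 < w S →
      ∀ a ∈ S, evidence F A X t ω a (deriv F.b η) ≤
        ENNReal.ofReal (subsetThreshold w δ S / S.card) := by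
    simp only [Filter.eventually_all]
    intro S hS hwS a ha
    have hc : (0 : ℝ) < S.card := by exact_mod_cast hS.card_pos
    obtain ⟨η₀, hη₀, hle⟩ := exists_evidence_le hη₁ (hfin S hS hwS a ha)
      (div_pos (subsetThreshold_pos hw hδ0 hδ1 hS hwS) hc)
    filter_upwards [Filter.eventually_le_atBot (⟨η₀, hη₀⟩ : F.Θ)] with η hη
    exact hle η η.2 hη
  obtain ⟨⟨η₀, hη₀⟩, hle⟩ := hev.exists
  have hobj₀ : objective F A X w δ t ω (deriv F.b η₀) ≤ 0 := by
    rw [objective_le_zero_iff hw hδ0 hδ1]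
    intro S hS hwS
    have hc : (0 : ℝ) < S.card := by exact_mod_cast hS.card_pos
    refine (Finset.sum_le_sum (hle S hS hwS)).trans ?_
    rw [Finset.sum_const, nsmul_eq_mul, ← ENNReal.ofReal_natCast, ← ENNReal.ofReal_mul hc.le,
      mul_div_cancel₀ _ hc.ne']
  obtain ⟨η, hη, heq⟩ := F.convex_Θ.isPreconnected.intermediate_value hη₀ hη₁
    continuousOn_objective ⟨hobj₀, h0⟩
  exact ⟨_, F.deriv_mem_means hη, heq⟩

/-- The means belong to the confidence regions of all times with probability at least `1 - δ`. -/
lemma IsBandit.measure_mem_confRegion [MeasurableSpace Ω] {P : Measure Ω}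
    [IsProbabilityMeasure P] {μ : Fin K → ℝ} (h : IsBandit F μ P A X)
    (hμ : ∀ a, μ a ∈ F.means) (hw : IsPrior w) (hδ0 : 0 < δ) (hδ1 : δ < 1) :
    ENNReal.ofReal (1 - δ) ≤ P {ω | ∀ t, μ ∈ confRegion F A X w δ t ω} := by
  set G := {ω | ∀ t, μ ∈ confRegion F A X w δ t ω}
  have hsub : Gᶜ ⊆ ⋃ S : Finset (Fin K), {ω | S.Nonempty ∧ 0 < w S ∧ ∃ t,
      ENNReal.ofReal (subsetThreshold w δ S) < ∑ a ∈ S, evidence F A X t ω a (μ a)} := by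
    intro ω hω
    by_contra hcon
    refine hω fun t => ⟨hμ, fun S hS hwS => ?_⟩
    by_contra hlt
    exact hcon (Set.mem_iUnion.2 ⟨S, hS, hwS, t, not_le.1 hlt⟩)
  have hS : ∀ S : Finset (Fin K), P {ω | S.Nonempty ∧ 0 < w S ∧ ∃ t,
      ENNReal.ofReal (subsetThreshold w δ S) < ∑ a ∈ S, evidence F A X t ω a (μ a)} ≤
      ENNReal.ofReal (δ * w S) := by
    intro S
    by_cases hne : S.Nonempty ∧ 0 < w S
    · have := h.measure_sum_evidence_le hμ hne.1 (log_one_div_pos hw hδ0 hδ1 hne.2)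
      rw [one_div, Real.log_inv, neg_neg, Real.exp_log (mul_pos hδ0 hne.2)] at this
      refine (measure_mono fun ω hω => ?_).trans this
      obtain ⟨-, -, hω⟩ := hω
      simp only [subsetThreshold, one_div, Real.log_inv] at hω
      exact hω
    · rw [show {ω | S.Nonempty ∧ 0 < w S ∧ ∃ t, ENNReal.ofReal (subsetThreshold w δ S) <
        ∑ a ∈ S, evidence F A X t ω a (μ a)} = ∅ from
          Set.eq_empty_of_forall_notMem fun ω hω => hne ⟨hω.1, hω.2.1⟩, measure_empty]
      exact zero_le
  have hcompl : P Gᶜ ≤ ENNReal.ofReal δ := by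
    refine (measure_mono hsub).trans ((measure_iUnion_fintype_le _ _).trans
      ((Finset.sum_le_sum fun S _ => hS S).trans ?_))
    rw [← ENNReal.ofReal_sum_of_nonneg fun S _ => mul_nonneg hδ0.le (hw.nonneg S),
      ← Finset.mul_sum, hw.sum_eq_one, mul_one]
  have h1 : 1 ≤ P G + P Gᶜ := by
    rw [← measure_univ (μ := P), ← Set.union_compl_self G]
    exact measure_union_le _ _
  rw [ENNReal.ofReal_sub _ hδ0.le, ENNReal.ofReal_one, tsub_le_iff_right]
  exact h1.trans (by gcongr)

end Bandit

theorem proposition7p1 {K : ℕ} {Ω : Type*} [MeasurableSpace Ω]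
    (P : Measure Ω) [IsProbabilityMeasure P]
    (F : ExpFamily) (μ : Fin K → ℝ) (hμ : ∀ a, μ a ∈ F.means)
    (A : ℕ → Ω → Fin K) (X : ℕ → Ω → ℝ) (hAX : IsBandit F μ P A X)
    (w : Finset (Fin K) → ℝ) (hw : IsPrior w)
    (δ : ℝ) (hδ0 : 0 < δ) (hδ1 : δ < 1) :
    -- with probability at least `1 - δ`, the solution bounds the minimal mean at all times
    ENNReal.ofReal (1 - δ) ≤
        P {ω | ∀ t : ℕ, ∀ θ : ℝ, IsSolution F A X w δ t ω θ → ⨅ a, μ a ≤ θ} ∧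
    -- the solution is the projected upper confidence bound (so there is at most one)
    (∀ (t : ℕ) (ω : Ω) (θ : ℝ), IsSolution F A X w δ t ω θ →
        IsGreatest (projRegion F A X w δ t ω) θ) ∧
    -- there is a solution as soon as the left-hand side is nonnegative and finite somewhere
    (∀ (t : ℕ) (ω : Ω),
        (∃ θ₁ ∈ F.means, 0 ≤ objective F A X w δ t ω θ₁ ∧ objective F A X w δ t ω θ₁ ≠ ⊤) →
        ∃ θ, IsSolution F A X w δ t ω θ) := by
  refine ⟨(hAX.measure_mem_confRegion hμ hw hδ0 hδ1).trans (measure_mono fun ω hω t θ hθ =>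
    hθ.iInf_le hw hδ0 hδ1 (hω t)), fun t ω θ hθ => hθ.isGreatest hw hδ0 hδ1,
    fun t ω h => exists_isSolution hw hδ0 hδ1 h⟩
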